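/- Let $\kappa>0$. For $d\in\mathbb N$ let $\mathbb T^d=\mathbb R^d/\mathbb Z^d$ be the $d$-dimensional flat unit torus with geodesic distance $\mathrm{dist}$, and let $\rho$ be the uniform probability measure on $\mathbb T^d$. For finite non-negative Borel measures $\mu,\nu$ on $\mathbb T^d$ the squared Hellinger--Kantorovich distance with length scale $\kappa$ is $$\mathrm{HK}_\kappa^2(\mu,\nu)=\inf_{\gamma}\Big\{\int \hat c_\kappa(x,y)\,d\gamma(x,y)+\mathrm{KL}(P_1\gamma\,|\,\mu)+\mathrm{KL}(P_2\gamma\,|\,\nu)\Big\},$$ where the infimum is over all finite non-negative Borel measures $\gamma$ on $\mathbb T^d\times\mathbb T^d$ with marginals $P_1\gamma,P_2\gamma$; $\hat c_\kappa(x,y)=-2\log\cos(\mathrm{dist}(x,y)/\kappa)$ if $\mathrm{dist}(x,y)\le\kappa\pi/2$ (with value $+\infty$ at equality) and $\hat c_\kappa(x,y)=+\infty$ otherwise; and $\mathrm{KL}(\mu|\nu)=\int\varphi\big(\tfrac{d\mu}{d\nu}\big)\,d\nu$ with $\varphi(s)=s\log s-s+1$, $\varphi(0)=1$, if $\mu\ll\nu$,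 and $\mathrm{KL}(\mu|\nu)=+\infty$ otherwise. A barycenter is a finite non-negative Borel measure $\nu$ on $\mathbb T^d$ that minimizes $$J(\nu)=\int_{\mathbb T^d}\mathrm{HK}_\kappa^2(\delta_x,\nu)\,d\rho(x)$$ among all such measures. A measure is called discrete if it is concentrated on a countable set, i.e. if it is a countable sum of weighted Dirac measures. Then: (a) If $d>1$, there is no discrete barycenter (for any $\kappa>0$). (b) If $d=1$ and $\kappa\pi$ is irrational or $\kappa\pi>1$, there is no discrete barycenter. (c) If $d=1$ and $\kappa\pi$ is rational with $\kappa\pi\le 1$, there exist discrete barycenters, and even one with finitely many atoms. -/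

import Mathlib

open MeasureTheory
open scoped ENNReal

noncomputable section

/-- Geodesic distance of the flat unit torus `ℝ^d / ℤ^d`: each coordinate distance in
`UnitAddCircle = ℝ / ℤ` is the distance to the nearest integer translate, and the coordinates are
combined with the Euclidean norm (the ambient metric on the product type would be the sup metric). -/
def torusDist {d : ℕ} (x y : UnitAddTorus (Fin d)) : ℝ :=
  √(∑ i, dist (x i) (y i) ^ 2)

/-- Transport cost of two points at distance `r`: `-2 log cos (r / κ)` as long as `r ≤ κ π / 2`,
with the value `+∞` at `r = κ π / 2`, where the cosine vanishes; and `+∞` beyond. -/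
def hkCost (κ r : ℝ) : ℝ≥0∞ :=
  if r < κ * Real.pi / 2 then ENNReal.ofReal (-2 * Real.log (Real.cos (r / κ))) else ∞

/-- Squared Hellinger-Kantorovich distance with length scale `κ` of two finite measures, in the
soft-marginal formulation, with respect to the distance function `D`. For finite measures,
`InformationTheory.klDiv μ ν = ∫ (s log s - s + 1) dν`, where `s = dμ/dν`, if `μ ≪ ν`, and
it is `+∞` otherwise. -/
def hkSq {X : Type*} [MeasurableSpace X] (D : X → X → ℝ) (κ : ℝ) (μ ν : Measure X) : ℝ≥0∞ :=
  ⨅ γ : FiniteMeasure (X × X),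
    (∫⁻ p, hkCost κ (D p.1 p.2) ∂(γ : Measure (X × X)))
      + InformationTheory.klDiv (γ : Measure (X × X)).fst μ
      + InformationTheory.klDiv (γ : Measure (X × X)).snd ν

/-- Barycenter objective for Dirac inputs whose locations are distributed according to `ρ`. -/
def hkObjective {X : Type*} [MeasurableSpace X] (D : X → X → ℝ) (κ : ℝ) (ρ ν : Measure X) :
    ℝ≥0∞ :=
  ∫⁻ x, hkSq D κ (Measure.dirac x) ν ∂ρ

/-- `ν` minimizes the barycenter objective over all non-negative finite measures. -/
def IsHKBarycenter {X : Type*} [MeasurableSpace X] (D : X → X → ℝ) (κ : ℝ) (ρ : Measure X)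
    (ν : FiniteMeasure X) : Prop :=
  ∀ ν' : FiniteMeasure X, hkObjective D κ ρ ν ≤ hkObjective D κ ρ ν'

/-- `ν` is a barycenter on the `d`-torus of Dirac inputs distributed according to the uniform
probability measure (`volume`). -/
def IsTorusBarycenter {d : ℕ} (κ : ℝ) (ν : FiniteMeasure (UnitAddTorus (Fin d))) : Prop :=
  IsHKBarycenter torusDist κ volume ν

/-- A measure is discrete if it is concentrated on a countable set, i.e. it is a countable sum of
weighted Dirac measures. -/
def IsDiscreteMeasure {X : Type*} [MeasurableSpace X] (ν : Measure X) : Prop :=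
  ∃ S : Set X, S.Countable ∧ ν Sᶜ = 0

/-- A measure is a finite sum of weighted Dirac measures. -/
def IsFinitelyAtomic {X : Type*} [MeasurableSpace X] (ν : Measure X) : Prop :=
  ∃ S : Set X, S.Finite ∧ ν Sᶜ = 0

end

/-! Against a Dirac mass the Hellinger-Kantorovich problem is solved explicitly: with k = `cosKernel
κ` applied to the distance, the squared distance from δ_x to ν equals ν(X) + 1 - 2 √p(x), where p(x)
= ∫ k(x,y) dν(y) is the `potential` (at least when p(x) > 0; the lower bound always holds). Let M be
the mass of ν and G = `meanKernel`. Since ∫ p = M G, expanding ∫ (√p - G)² gives G (M + G - 2 ∫ √p),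
so the objective is at least 1 - G, with equality only if p is identically G². The uniform measure
of mass G attains this bound, so barycenters are exactly the measures with p = G² everywhere
(`isTorusBarycenter_iff`).

The rest asks whether a discrete measure can have a constant potential. Put R = κπ/2. An atom is
betrayed by a singularity of k that the other mass cannot cancel.

If κπ > 1, then k has an upward kink at the antipode of its centre in the first coordinate. All
second differences of k in that direction are bounded below by -C h², so a kink of order h from an
atom cannot be compensated (`potential_const_atomless_of_one_lt`).

If κπ ≤ 1, then k is C^{1,1} along lines, and its second derivative jumps only on the sphere of
radius R. A third difference divided by h² converges to three times the jump, and dominated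
convergence makes the total jump vanish at each point (`integral_eq_zero_of_tendsto_thirdDiff`). For
d ≥ 2, some point of a circle around a given atom avoids the R-spheres of all other atoms, so one
jump stands alone, a contradiction. For d = 1 with κπ < 1, the two points at distance R from x give
opposite jumps, so ν{y} is invariant under the shift by κπ; if κπ is irrational, an atom would have
infinitely many copies of equal mass.

If κπ = m/N is rational, at most 1, and m ≥ 2, equal atoms spaced by 1/N work: exactly m terms can
contribute, and their cosines are equally spaced on a full turn and cancel (`sum_cosKernel_eq`). -/

open InformationTheory

/-! ### The truncated cosine-squared kernel and pointwise entropy inequalities -/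

/-- The kernel `exp (-hkCost κ r)`, that is `cos² (r / κ)` cut off at `r = κ π / 2`. -/
noncomputable def cosKernel (κ r : ℝ) : ℝ := Real.cos (min r (κ * Real.pi / 2) / κ) ^ 2

theorem cosKernel_nonneg (κ r : ℝ) : 0 ≤ cosKernel κ r := sq_nonneg _

theorem cosKernel_le_one (κ r : ℝ) : cosKernel κ r ≤ 1 := Real.cos_sq_le_one _

theorem abs_cosKernel_le_one (κ r : ℝ) : |cosKernel κ r| ≤ 1 := by
  rw [abs_of_nonneg (cosKernel_nonneg κ r)]; exact cosKernel_le_one κ r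

theorem continuous_cosKernel (κ : ℝ) : Continuous (cosKernel κ) := by
  unfold cosKernel; fun_prop

theorem cosKernel_of_lt {κ r : ℝ} (h : r < κ * Real.pi / 2) :
    cosKernel κ r = Real.cos (r / κ) ^ 2 := by
  rw [cosKernel, min_eq_left h.le]

theorem cosKernel_of_le {κ r : ℝ} (hκ : 0 < κ) (h : κ * Real.pi / 2 ≤ r) :
    cosKernel κ r = 0 := by
  have : κ * Real.pi / 2 / κ = Real.pi / 2 := by field_simp
  rw [cosKernel, min_eq_right h, this, Real.cos_pi_div_two]; norm_num

theorem cos_div_pos {κ r : ℝ} (hκ : 0 < κ) (hr : 0 ≤ r) (h : r < κ * Real.pi / 2) :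
    0 < Real.cos (r / κ) := by
  apply Real.cos_pos_of_mem_Ioo
  have := Real.pi_pos
  constructor
  · have : 0 ≤ r / κ := by positivity
    linarith
  · rw [div_lt_iff₀ hκ]; linarith

theorem hkCost_of_lt {κ r : ℝ} (hκ : 0 < κ) (hr : 0 ≤ r) (h : r < κ * Real.pi / 2) :
    0 < cosKernel κ r ∧ hkCost κ r = ENNReal.ofReal (-Real.log (cosKernel κ r)) := by
  have := cos_div_pos hκ hr h
  rw [cosKernel_of_lt h]
  refine ⟨by positivity, ?_⟩
  rw [hkCost, if_pos h, Real.log_pow]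
  congr 1; push_cast; exact neg_mul _ _

theorem measurable_hkCost (κ : ℝ) : Measurable (hkCost κ) := by
  unfold hkCost
  refine Measurable.ite measurableSet_Iio ?_ measurable_const
  exact ENNReal.measurable_ofReal.comp
    ((Real.measurable_log.comp (Real.measurable_cos.comp (measurable_id.div_const κ))).const_mul _)

theorem mul_klFun_div {s t : ℝ} (hs : 0 ≤ s) (ht : 0 < t) :
    t * klFun (s / t) = s * Real.log s - s * Real.log t + t - s := by
  rw [klFun_apply]
  rcases hs.eq_or_lt with rfl | hs
  · simp
  · rw [Real.log_div hs.ne' ht.ne']; field_simp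

theorem one_add_mul_log_le_klFun {m l : ℝ} (hm : 0 ≤ m) (hl : 0 < l) :
    1 + m * Real.log l ≤ klFun m + l := by
  have h1 := mul_klFun_div hm hl
  have h2 := mul_nonneg hl.le (klFun_nonneg (div_nonneg hm hl.le))
  rw [klFun_apply]; linarith

/-- For k > 0 this is nonnegativity of (k/l) `klFun` (s l / k). The term s log l is split into its
positive and negative parts on the two sides, so that the inequality makes sense in `ℝ≥0∞` for
either sign. -/
theorem one_le_cost_mul_add_klFun {κ r s l : ℝ} (hκ : 0 < κ) (hr : 0 ≤ r) (hs : 0 ≤ s)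
    (hl : 0 < l) :
    1 + ENNReal.ofReal s * ENNReal.ofReal (-Real.log l) ≤
      ENNReal.ofReal s * hkCost κ r + ENNReal.ofReal (klFun s) + ENNReal.ofReal (cosKernel κ r / l)
        + ENNReal.ofReal s * ENNReal.ofReal (Real.log l) := by
  have hk := cosKernel_nonneg κ r
  rcases hs.eq_or_lt with rfl | hs
  · simp only [ENNReal.ofReal_zero, zero_mul, add_zero, klFun_zero, ENNReal.ofReal_one, zero_add]
    exact le_self_add
  rcases lt_or_ge r (κ * Real.pi / 2) with h | h
  · obtain ⟨hw, hc⟩ := hkCost_of_lt hκ hr h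
    have hlog : 0 ≤ -Real.log (cosKernel κ r) := by
      have := Real.log_nonpos hw.le (cosKernel_le_one κ r); linarith
    rw [hc, ← ENNReal.ofReal_mul hs.le, ← ENNReal.ofReal_mul hs.le, ← ENNReal.ofReal_mul hs.le,
      ← ENNReal.ofReal_add (by positivity) (klFun_nonneg hs.le),
      ← ENNReal.ofReal_add (add_nonneg (by positivity) (klFun_nonneg hs.le)) (by positivity)]
    have key : 1 ≤ s * -Real.log (cosKernel κ r) + klFun s + cosKernel κ r / l
        + s * Real.log l := by
      have h1 := mul_klFun_div hs.le (div_pos hw hl)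
      have h2 := mul_nonneg (div_pos hw hl).le (klFun_nonneg (div_pos hs (div_pos hw hl)).le)
      rw [Real.log_div hw.ne' hl.ne'] at h1
      rw [klFun_apply]; linarith
    rcases le_total 0 (Real.log l) with h0 | h0
    · rw [ENNReal.ofReal_of_nonpos (p := s * -Real.log l) (by nlinarith), add_zero,
        ← ENNReal.ofReal_add (add_nonneg (add_nonneg (by positivity) (klFun_nonneg hs.le))
          (by positivity)) (by positivity)]
      rw [← ENNReal.ofReal_one]
      exact ENNReal.ofReal_le_ofReal key
    · rw [ENNReal.ofReal_of_nonpos (p := s * Real.log l) (by nlinarith), add_zero,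
        ← ENNReal.ofReal_one, ← ENNReal.ofReal_add zero_le_one (by nlinarith)]
      exact ENNReal.ofReal_le_ofReal (by linarith)
  · have : hkCost κ r = ∞ := if_neg (not_lt.mpr h)
    rw [this, ENNReal.mul_top (by simpa using hs)]
    simp

/-! ### Explicit distance from a Dirac mass -/

section
variable {X : Type*} [MeasurableSpace X] {D : X → X → ℝ} {κ : ℝ} {x : X} {ν : Measure X}

theorem integrable_cosKernel [IsFiniteMeasure ν] (hD : Measurable (D x)) :
    Integrable (fun y => cosKernel κ (D x y)) ν :=
  (integrable_const (1 : ℝ)).mono'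
    ((continuous_cosKernel κ).measurable.comp hD).aestronglyMeasurable
    (Filter.Eventually.of_forall fun _ => abs_cosKernel_le_one _ _)

variable [MeasurableSingletonClass X]

/-- Weak duality: `hA` integrates the pointwise inequality against ν, `hB` is the scalar one for the
total mass of γ, and on adding them the multiplier terms γ(X) log l cancel. The best l is the square
root of the potential. -/
theorem mass_add_one_le_hk_energy (hκ : 0 < κ) (hD : Measurable (D x)) (hD0 : ∀ y, 0 ≤ D x y)
    [IsFiniteMeasure ν] (γ : Measure (X × X)) [IsFiniteMeasure γ] {l : ℝ} (hl : 0 < l) :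
    ν Set.univ + 1 ≤ ((∫⁻ p, hkCost κ (D p.1 p.2) ∂γ) + klDiv γ.fst (Measure.dirac x)
      + klDiv γ.snd ν) + ENNReal.ofReal ((∫ y, cosKernel κ (D x y) ∂ν) / l + l) := by
  by_cases h1 : γ.fst ≪ Measure.dirac x
  swap
  · simp [klDiv_of_not_ac h1]
  by_cases h2 : γ.snd ≪ ν
  swap
  · simp [klDiv_of_not_ac h2]
  have hcost : ∫⁻ p, hkCost κ (D p.1 p.2) ∂γ
      = ∫⁻ y, γ.snd.rnDeriv ν y * hkCost κ (D x y) ∂ν := by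
    -- A first marginal absolutely continuous with respect to δ_x confines γ to {x} × X.
    have hx : ∀ᵐ p ∂γ, p.1 = x := by
      have : γ.fst {x}ᶜ = 0 := h1 (by simp)
      rw [Measure.fst_apply (MeasurableSet.singleton x).compl] at this
      exact this
    have hcD : Measurable fun y => hkCost κ (D x y) := (measurable_hkCost κ).comp hD
    rw [lintegral_rnDeriv_mul h2 hcD.aemeasurable, Measure.snd, lintegral_map hcD measurable_snd]
    refine lintegral_congr_ae ?_
    filter_upwards [hx] with p hp
    simp [hp]
  have hm : ∫⁻ y, γ.snd.rnDeriv ν y ∂ν = γ Set.univ := by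
    rw [Measure.lintegral_rnDeriv h2, Measure.snd_univ]
  have hsmeas := Measure.measurable_rnDeriv γ.snd ν
  have hA : ν Set.univ + γ Set.univ * ENNReal.ofReal (-Real.log l) ≤
      (∫⁻ p, hkCost κ (D p.1 p.2) ∂γ) + klDiv γ.snd ν
        + ENNReal.ofReal ((∫ y, cosKernel κ (D x y) ∂ν) / l)
        + γ Set.univ * ENNReal.ofReal (Real.log l) := by
    have hI : ENNReal.ofReal ((∫ y, cosKernel κ (D x y) ∂ν) / l)
        = ∫⁻ y, ENNReal.ofReal (cosKernel κ (D x y) / l) ∂ν := by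
      rw [← integral_div, ofReal_integral_eq_lintegral_ofReal
        ((integrable_cosKernel hD).div_const l)]
      exact Filter.Eventually.of_forall fun y => div_nonneg (cosKernel_nonneg _ _) hl.le
    have hkm : Measurable fun y => ENNReal.ofReal (cosKernel κ (D x y) / l) :=
      ENNReal.measurable_ofReal.comp
        ((((continuous_cosKernel κ).measurable.comp hD)).div_const l)
    have hfm : Measurable fun y => ENNReal.ofReal (klFun (γ.snd.rnDeriv ν y).toReal) :=
      ENNReal.measurable_ofReal.comp (measurable_klFun.comp hsmeas.ennreal_toReal)
    have hcm : Measurable fun y => γ.snd.rnDeriv ν y * hkCost κ (D x y) :=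
      hsmeas.mul ((measurable_hkCost κ).comp hD)
    have hcfm : Measurable fun y => γ.snd.rnDeriv ν y * hkCost κ (D x y)
        + ENNReal.ofReal (klFun (γ.snd.rnDeriv ν y).toReal) := hcm.add hfm
    have hcfkm : Measurable fun y => γ.snd.rnDeriv ν y * hkCost κ (D x y)
        + ENNReal.ofReal (klFun (γ.snd.rnDeriv ν y).toReal)
        + ENNReal.ofReal (cosKernel κ (D x y) / l) := hcfm.add hkm
    rw [hcost, klDiv_eq_lintegral_klFun_of_ac h2, hI, ← hm, ← lintegral_mul_const _ hsmeas,
      ← lintegral_mul_const _ hsmeas, ← lintegral_one, ← lintegral_add_left measurable_const,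
      ← lintegral_add_left hcm, ← lintegral_add_left hcfm,
      ← lintegral_add_left hcfkm]
    refine lintegral_mono_ae ?_
    filter_upwards [Measure.rnDeriv_lt_top γ.snd ν] with y hy
    have := one_le_cost_mul_add_klFun hκ (hD0 y) (s := (γ.snd.rnDeriv ν y).toReal)
      ENNReal.toReal_nonneg hl
    rwa [ENNReal.ofReal_toReal hy.ne] at this
  have hB : 1 + γ Set.univ * ENNReal.ofReal (Real.log l) ≤
      klDiv γ.fst (Measure.dirac x) + ENNReal.ofReal l
        + γ Set.univ * ENNReal.ofReal (-Real.log l) := by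
    have h3 := mul_log_le_klDiv γ.fst (Measure.dirac x)
    have hreal : γ.fst.real Set.univ = (γ Set.univ).toReal := by
      rw [measureReal_def, Measure.fst_univ]
    simp only [probReal_univ, div_one, hreal] at h3
    set m := (γ Set.univ).toReal with hmdef
    have hm0 : 0 ≤ m := ENNReal.toReal_nonneg
    have hγ : γ Set.univ = ENNReal.ofReal m := (ENNReal.ofReal_toReal (measure_ne_top _ _)).symm
    rw [← klFun_apply m] at h3
    have h4 := one_add_mul_log_le_klFun hm0 hl
    have hkn := klFun_nonneg hm0
    refine le_trans ?_ (add_le_add_left (add_le_add_left h3 _) _)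
    rw [hγ, ← ENNReal.ofReal_mul hm0, ← ENNReal.ofReal_mul hm0, ← ENNReal.ofReal_add hkn hl.le]
    rcases le_total 0 (Real.log l) with h0 | h0
    · rw [ENNReal.ofReal_of_nonpos (p := m * -Real.log l) (by nlinarith), add_zero,
        ← ENNReal.ofReal_one, ← ENNReal.ofReal_add zero_le_one (by positivity)]
      exact ENNReal.ofReal_le_ofReal h4
    · rw [ENNReal.ofReal_of_nonpos (p := m * Real.log l) (by nlinarith), add_zero,
        ← ENNReal.ofReal_add (by positivity) (by nlinarith), ← ENNReal.ofReal_one]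
      exact ENNReal.ofReal_le_ofReal (by linarith)
  have hfin : γ Set.univ * ENNReal.ofReal (-Real.log l) + γ Set.univ * ENNReal.ofReal (Real.log l)
      ≠ ∞ := by finiteness
  have hI0 : 0 ≤ (∫ y, cosKernel κ (D x y) ∂ν) / l :=
    div_nonneg (integral_nonneg fun y => cosKernel_nonneg _ _) hl.le
  rw [ENNReal.ofReal_add hI0 hl.le, ← ENNReal.add_le_add_iff_right hfin]
  calc _ = (ν Set.univ + γ Set.univ * ENNReal.ofReal (-Real.log l))
        + (1 + γ Set.univ * ENNReal.ofReal (Real.log l)) := by ring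
    _ ≤ _ := add_le_add hA hB
    _ = _ := by ring

theorem ofReal_le_hkSq (hκ : 0 < κ) (hD : Measurable (D x)) (hD0 : ∀ y, 0 ≤ D x y)
    [IsFiniteMeasure ν] :
    ENNReal.ofReal (ν.real Set.univ + 1 - 2 * √(∫ y, cosKernel κ (D x y) ∂ν))
      ≤ hkSq D κ (Measure.dirac x) ν := by
  refine le_iInf fun γ => ?_
  set T := (∫⁻ p, hkCost κ (D p.1 p.2) ∂(γ : Measure (X × X)))
      + klDiv (γ : Measure (X × X)).fst (Measure.dirac x)
      + klDiv (γ : Measure (X × X)).snd ν with hT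
  set I := ∫ y, cosKernel κ (D x y) ∂ν with hI
  have hI0 : 0 ≤ I := integral_nonneg fun y => cosKernel_nonneg _ _
  by_cases hTt : T = ∞
  · rw [hTt]; exact le_top
  -- The multiplier √I itself may be 0, so √I + ε is used.
  refine ENNReal.ofReal_le_of_le_toReal (le_of_forall_pos_le_add fun ε hε => ?_)
  have hs : 0 < √I + ε := by positivity
  have h := mass_add_one_le_hk_energy hκ hD hD0 (ν := ν) (γ : Measure (X × X)) hs
  rw [← hT, ← hI] at h
  have hle : 0 ≤ I / (√I + ε) + (√I + ε) := by positivity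
  have h' := ENNReal.toReal_mono (by finiteness) h
  rw [ENNReal.toReal_add (by finiteness) (by finiteness),
    ENNReal.toReal_add hTt (by finiteness), ENNReal.toReal_ofReal hle, ENNReal.toReal_one] at h'
  have h3 : I / (√I + ε) ≤ √I := by
    rw [div_le_iff₀ hs]
    nlinarith [Real.mul_self_sqrt hI0, Real.sqrt_nonneg I]
  rw [measureReal_def]; linarith

/-- The optimal plan is δ_x ⊗ (k/√I) ν: with this density the logarithm of the kernel in the entropy
cancels the transport cost pointwise. -/
theorem hkSq_le_ofReal (hκ : 0 < κ) (hD : Measurable fun p : X × X => D p.1 p.2)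
    (hD0 : ∀ y, 0 ≤ D x y) [IsFiniteMeasure ν] (hpos : 0 < ∫ y, cosKernel κ (D x y) ∂ν) :
    hkSq D κ (Measure.dirac x) ν
      ≤ ENNReal.ofReal (ν.real Set.univ + 1 - 2 * √(∫ y, cosKernel κ (D x y) ∂ν)) := by
  have hDx : Measurable (D x) := hD.comp measurable_prodMk_left
  set I := ∫ y, cosKernel κ (D x y) ∂ν with hI
  set m := √I with hmdef
  have hm : 0 < m := Real.sqrt_pos.mpr hpos
  have hmI : m * m = I := Real.mul_self_sqrt hpos.le
  set w : X → ℝ := fun y => cosKernel κ (D x y) / m with hw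
  have hw0 : ∀ y, 0 ≤ w y := fun y => div_nonneg (cosKernel_nonneg _ _) hm.le
  have hwm : Measurable w := ((continuous_cosKernel κ).measurable.comp hDx).div_const m
  have hwi : Integrable w ν := (integrable_cosKernel hDx).div_const m
  have hwint : ∫ y, w y ∂ν = m := by
    rw [hw, integral_div, ← hI, ← hmI]; field_simp
  set σ : Measure X := ν.withDensity (fun y => ENNReal.ofReal (w y)) with hσ
  have hσuniv : σ Set.univ = ENNReal.ofReal m := by
    rw [hσ, withDensity_apply _ MeasurableSet.univ, Measure.restrict_univ,
      ← ofReal_integral_eq_lintegral_ofReal hwi (Filter.Eventually.of_forall hw0), hwint]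
  have : IsFiniteMeasure σ := ⟨by rw [hσuniv]; exact ENNReal.ofReal_lt_top⟩
  set γ : FiniteMeasure (X × X) := ⟨(Measure.dirac x).prod σ, inferInstance⟩ with hγ
  have hγ' : (γ : Measure (X × X)) = (Measure.dirac x).prod σ := rfl
  refine (iInf_le _ γ).trans ?_
  have hfst : (γ : Measure (X × X)).fst = m.toNNReal • Measure.dirac x := by
    rw [hγ', Measure.fst, Measure.map_fst_prod, hσuniv]; rfl
  have hsnd : (γ : Measure (X × X)).snd = σ := by
    rw [hγ', Measure.snd_prod]
  have hk1 : klDiv (γ : Measure (X × X)).fst (Measure.dirac x) = ENNReal.ofReal (klFun m) := by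
    have hac : m.toNNReal • Measure.dirac x ≪ Measure.dirac x :=
      Measure.AbsolutelyContinuous.rfl.smul_left _
    have hint : Integrable (llr (m.toNNReal • Measure.dirac x) (Measure.dirac x))
        (m.toNNReal • Measure.dirac x) := by
      have : Integrable (llr (m.toNNReal • Measure.dirac x) (Measure.dirac x))
          (Measure.dirac x) := integrable_dirac (by simp)
      exact this.smul_measure_nnreal
    have h := toReal_klDiv_smul_left (μ := Measure.dirac x) (ν := Measure.dirac x)
      Measure.AbsolutelyContinuous.rfl (integrable_dirac (by simp)) m.toNNReal
    rw [hfst, ← ENNReal.ofReal_toReal (klDiv_ne_top hac hint), h, klFun_apply]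
    congr 1
    simp [Real.coe_toNNReal m hm.le]; ring
  have hpt : ∀ y, 0 ≤ -(w y * Real.log m) - w y + 1 ∧
      ENNReal.ofReal (w y) * hkCost κ (D x y) + ENNReal.ofReal (klFun (w y))
        = ENNReal.ofReal (-(w y * Real.log m) - w y + 1) := by
    intro y
    rcases lt_or_ge (D x y) (κ * Real.pi / 2) with h | h
    · obtain ⟨hk, hc⟩ := hkCost_of_lt hκ (hD0 y) h
      have hlog : 0 ≤ -Real.log (cosKernel κ (D x y)) := by
        have := Real.log_nonpos hk.le (cosKernel_le_one κ (D x y)); linarith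
      have e : w y * -Real.log (cosKernel κ (D x y)) + klFun (w y)
          = -(w y * Real.log m) - w y + 1 := by
        rw [klFun_apply]
        have : Real.log (w y) = Real.log (cosKernel κ (D x y)) - Real.log m :=
          Real.log_div hk.ne' hm.ne'
        rw [this]; ring
      have e0 := mul_nonneg (hw0 y) hlog
      have e1 := klFun_nonneg (hw0 y)
      refine ⟨by linarith, ?_⟩
      rw [hc, ← ENNReal.ofReal_mul (hw0 y), ← ENNReal.ofReal_add e0 e1, e]
    -- Beyond the cutoff the cost is ∞ but the density vanishes, and 0 * ∞ = 0.
    · have : w y = 0 := by simp [hw, cosKernel_of_le hκ h]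
      simp [this, klFun_zero]
  have hval : ∫ y, (-(w y * Real.log m) - w y + 1) ∂ν
      = ν.real Set.univ - m * Real.log m - m := by
    have h1 : Integrable (fun y => -(w y * Real.log m)) ν := (hwi.mul_const _).neg
    have h2 : Integrable (fun y => -(w y * Real.log m) - w y) ν := h1.sub hwi
    rw [integral_add h2 (integrable_const _), integral_sub h1 hwi, integral_neg,
      integral_mul_const, hwint]
    simp; ring
  have hcx : Measurable fun y => hkCost κ (D x y) := (measurable_hkCost κ).comp hDx
  have hmul : Measurable fun y => ENNReal.ofReal (w y) * hkCost κ (D x y) :=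
    (ENNReal.measurable_ofReal.comp hwm).mul hcx
  have hk2 : (∫⁻ p, hkCost κ (D p.1 p.2) ∂(γ : Measure (X × X)))
      + klDiv (γ : Measure (X × X)).snd ν
      = ENNReal.ofReal (ν.real Set.univ - m * Real.log m - m) := by
    have hac : σ ≪ ν := withDensity_absolutelyContinuous _ _
    have hc1 : ∫⁻ p, hkCost κ (D p.1 p.2) ∂(γ : Measure (X × X))
        = ∫⁻ y, ENNReal.ofReal (w y) * hkCost κ (D x y) ∂ν := by
      have hcD : Measurable fun p : X × X => hkCost κ (D p.1 p.2) :=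
        (measurable_hkCost κ).comp hD
      rw [hγ', lintegral_prod _ hcD.aemeasurable, lintegral_dirac' _ hcD.lintegral_prod_right', hσ,
        lintegral_withDensity_eq_lintegral_mul _ (by fun_prop) hcx]
      rfl
    have hrn : σ.rnDeriv ν =ᵐ[ν] fun y => ENNReal.ofReal (w y) :=
      Measure.rnDeriv_withDensity ν (by fun_prop)
    rw [hc1, hsnd, klDiv_eq_lintegral_klFun_of_ac hac, ← lintegral_add_left hmul]
    rw [lintegral_congr_ae (g := fun y => ENNReal.ofReal (-(w y * Real.log m) - w y + 1)),
      ← ofReal_integral_eq_lintegral_ofReal]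
    · rw [hval]
    · exact ((hwi.mul_const _).neg.sub hwi).add (integrable_const _)
    · exact Filter.Eventually.of_forall fun y => (hpt y).1
    · filter_upwards [hrn] with y hy
      rw [hy, ENNReal.toReal_ofReal (hw0 y), (hpt y).2]
  rw [add_right_comm, hk2, hk1]
  have h0 : 0 ≤ ν.real Set.univ - m * Real.log m - m :=
    hval ▸ integral_nonneg fun y => (hpt y).1
  rw [← ENNReal.ofReal_add h0 (klFun_nonneg hm.le), klFun_apply]
  exact ENNReal.ofReal_le_ofReal (by linarith)
end

/-! ### Barycenters as measures of constant potential -/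

instance isProbabilityMeasure_unitAddCircle :
    IsProbabilityMeasure (volume : Measure UnitAddCircle) :=
  ⟨UnitAddCircle.measure_univ⟩

section
variable {d : ℕ}

theorem torusDist_nonneg (x y : UnitAddTorus (Fin d)) : 0 ≤ torusDist x y := Real.sqrt_nonneg _

theorem continuous_torusDist :
    Continuous fun p : UnitAddTorus (Fin d) × UnitAddTorus (Fin d) => torusDist p.1 p.2 := by
  unfold torusDist; fun_prop

theorem continuous_torusDist_left (y : UnitAddTorus (Fin d)) :
    Continuous fun x => torusDist x y := by
  unfold torusDist; fun_prop

theorem continuous_torusDist_right (x : UnitAddTorus (Fin d)) : Continuous (torusDist x) := by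
  unfold torusDist; fun_prop

theorem torusDist_sub_zero (x y : UnitAddTorus (Fin d)) :
    torusDist (x - y) 0 = torusDist x y := by
  simp [torusDist, dist_eq_norm]

/-- The mean value of the kernel `cosKernel κ` over the torus. -/
noncomputable def meanKernel (κ : ℝ) (d : ℕ) : ℝ :=
  ∫ x : UnitAddTorus (Fin d), cosKernel κ (torusDist x 0)

/-- The convolution of a measure on the torus with the kernel `cosKernel κ`. -/
noncomputable def potential (κ : ℝ) (ν : Measure (UnitAddTorus (Fin d)))
    (x : UnitAddTorus (Fin d)) : ℝ :=
  ∫ y, cosKernel κ (torusDist x y) ∂ν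

variable {κ : ℝ}

theorem integral_cosKernel_left (y : UnitAddTorus (Fin d)) :
    ∫ x, cosKernel κ (torusDist x y) = meanKernel κ d := by
  simp_rw [← torusDist_sub_zero _ y]
  exact integral_sub_right_eq_self (fun x => cosKernel κ (torusDist x 0)) y

theorem integral_cosKernel_right (x : UnitAddTorus (Fin d)) :
    ∫ y, cosKernel κ (torusDist x y) = meanKernel κ d := by
  rw [← integral_cosKernel_left x]
  simp [torusDist, dist_comm]

theorem continuous_cosKernel_torusDist :
    Continuous fun p : UnitAddTorus (Fin d) × UnitAddTorus (Fin d) =>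
      cosKernel κ (torusDist p.1 p.2) :=
  (continuous_cosKernel κ).comp continuous_torusDist

theorem meanKernel_pos (hκ : 0 < κ) : 0 < meanKernel κ d := by
  have hc : Continuous fun x : UnitAddTorus (Fin d) => cosKernel κ (torusDist x 0) :=
    (continuous_cosKernel κ).comp (continuous_torusDist_left 0)
  refine hc.integral_pos_of_hasCompactSupport_nonneg_nonzero
    (HasCompactSupport.of_compactSpace _) (fun _ => cosKernel_nonneg _ _) (x := 0) ?_
  have : torusDist (0 : UnitAddTorus (Fin d)) 0 = 0 := by simp [torusDist]
  rw [this]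
  exact (hkCost_of_lt hκ le_rfl (by have := Real.pi_pos; positivity)).1.ne'

section
variable {ν : Measure (UnitAddTorus (Fin d))}

theorem potential_nonneg (x : UnitAddTorus (Fin d)) : 0 ≤ potential κ ν x :=
  integral_nonneg fun _ => cosKernel_nonneg _ _

variable [IsFiniteMeasure ν]

theorem integrable_cosKernel_torusDist (x : UnitAddTorus (Fin d)) :
    Integrable (fun y => cosKernel κ (torusDist x y)) ν :=
  integrable_cosKernel (continuous_torusDist_right x).measurable

theorem potential_le (x : UnitAddTorus (Fin d)) : potential κ ν x ≤ ν.real Set.univ := by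
  have := integral_mono (μ := ν) (integrable_cosKernel_torusDist (κ := κ) x)
    (integrable_const (1 : ℝ)) fun _ => cosKernel_le_one _ _
  simpa [potential] using this

theorem continuous_potential : Continuous (potential κ ν) := by
  refine continuous_of_dominated (bound := fun _ => 1) (fun x => ?_) (fun x => ?_)
    (integrable_const _) ?_
  · exact (integrable_cosKernel_torusDist x).aestronglyMeasurable
  · exact Filter.Eventually.of_forall fun y => abs_cosKernel_le_one _ _
  · exact Filter.Eventually.of_forall fun y =>
      (continuous_cosKernel κ).comp (continuous_torusDist_left y)

theorem integral_potential :
    ∫ x, potential κ ν x = ν.real Set.univ * meanKernel κ d := by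
  unfold potential
  rw [integral_integral_swap]
  · simp_rw [integral_cosKernel_left]; simp
  · exact (integrable_const (1 : ℝ)).mono'
      (continuous_cosKernel_torusDist.aestronglyMeasurable)
      (Filter.Eventually.of_forall fun _ => abs_cosKernel_le_one _ _)

theorem integrable_potential : Integrable (potential κ ν) :=
  continuous_potential.integrable_of_hasCompactSupport (HasCompactSupport.of_compactSpace _)

theorem integrable_sqrt_potential : Integrable fun x => √(potential κ ν x) :=
  (Real.continuous_sqrt.comp continuous_potential).integrable_of_hasCompactSupport
    (HasCompactSupport.of_compactSpace _)

theorem ofReal_le_hkObjective (hκ : 0 < κ) :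
    ENNReal.ofReal (ν.real Set.univ + 1 - 2 * ∫ x, √(potential κ ν x))
      ≤ hkObjective torusDist κ volume ν := by
  have h0 : ∀ x, 0 ≤ ν.real Set.univ + 1 - 2 * √(potential κ ν x) := fun x => by
    have h1 := Real.sqrt_le_sqrt (potential_le (κ := κ) (ν := ν) x)
    have h2 := Real.sq_sqrt (measureReal_nonneg (μ := ν) (s := Set.univ))
    nlinarith [sq_nonneg (√(ν.real Set.univ) - 1)]
  have hi : Integrable fun x => 2 * √(potential κ ν x) := integrable_sqrt_potential.const_mul 2
  have h : ν.real Set.univ + 1 - 2 * ∫ x, √(potential κ ν x)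
      = ∫ x, (ν.real Set.univ + 1 - 2 * √(potential κ ν x)) := by
    rw [integral_sub (integrable_const _) hi, integral_const_mul]; simp
  have hi' : Integrable fun x => ν.real Set.univ + 1 - 2 * √(potential κ ν x) :=
    (integrable_const _).sub hi
  rw [h, ofReal_integral_eq_lintegral_ofReal hi'
    (Filter.Eventually.of_forall h0)]
  exact lintegral_mono fun x => ofReal_le_hkSq hκ (continuous_torusDist_right x).measurable
    fun y => torusDist_nonneg x y

theorem measureReal_univ_of_potential_eq (hκ : 0 < κ)
    (h : ∀ x, potential κ ν x = meanKernel κ d ^ 2) : ν.real Set.univ = meanKernel κ d := by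
  have h1 := integral_potential (κ := κ) (ν := ν)
  have h2 := meanKernel_pos (d := d) hκ
  simp_rw [h] at h1
  simp only [integral_const, probReal_univ, one_smul] at h1
  nlinarith

theorem hkObjective_le_of_potential_eq (hκ : 0 < κ)
    (h : ∀ x, potential κ ν x = meanKernel κ d ^ 2) :
    hkObjective torusDist κ volume ν ≤ ENNReal.ofReal (1 - meanKernel κ d) := by
  have hG := meanKernel_pos (d := d) hκ
  have hM := measureReal_univ_of_potential_eq hκ h
  have : ∀ x, hkSq torusDist κ (Measure.dirac x) ν ≤ ENNReal.ofReal (1 - meanKernel κ d) := by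
    intro x
    have hx : ∫ y, cosKernel κ (torusDist x y) ∂ν = meanKernel κ d ^ 2 := h x
    have := hkSq_le_ofReal (ν := ν) (x := x) hκ continuous_torusDist.measurable
      (torusDist_nonneg x) (by rw [hx]; positivity)
    rw [hx, Real.sqrt_sq hG.le, hM] at this
    refine this.trans (ENNReal.ofReal_le_ofReal (by linarith))
  calc _ ≤ ∫⁻ _ : UnitAddTorus (Fin d), ENNReal.ofReal (1 - meanKernel κ d) := lintegral_mono this
    _ = _ := by simp

/-- Both parts come from ∫ (√p - G)² ≥ 0. In the equality case the integrand is continuous and the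
volume has full support, so √p = G at every point, not only almost everywhere. -/
theorem two_mul_integral_sqrt_potential_le (hκ : 0 < κ) :
    2 * ∫ x, √(potential κ ν x) ≤ ν.real Set.univ + meanKernel κ d ∧
    (2 * ∫ x, √(potential κ ν x) = ν.real Set.univ + meanKernel κ d →
      ∀ x, potential κ ν x = meanKernel κ d ^ 2) := by
  have hG := meanKernel_pos (d := d) hκ
  set G := meanKernel κ d with hGdef
  have hint : ∫ x, (√(potential κ ν x) - G) ^ 2
      = G * (ν.real Set.univ + G - 2 * ∫ x, √(potential κ ν x)) := by
    have : ∀ x, (√(potential κ ν x) - G) ^ 2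
        = potential κ ν x + G ^ 2 - 2 * G * √(potential κ ν x) := fun x => by
      rw [sub_sq, Real.sq_sqrt (potential_nonneg x)]; ring
    have hi : Integrable fun x => 2 * G * √(potential κ ν x) :=
      integrable_sqrt_potential.const_mul _
    have hi' : Integrable fun x => potential κ ν x + G ^ 2 :=
      integrable_potential.add (integrable_const _)
    simp_rw [this]
    rw [integral_sub hi' hi, integral_add integrable_potential (integrable_const _),
      integral_const_mul, integral_potential]
    simp only [integral_const, probReal_univ, one_smul, ← hGdef]
    ring
  have hc : Continuous fun x => (√(potential κ ν x) - G) ^ 2 :=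
    ((Real.continuous_sqrt.comp continuous_potential).sub continuous_const).pow 2
  have hnn := integral_nonneg (μ := volume) (f := fun x => (√(potential κ ν x) - G) ^ 2)
    fun x => sq_nonneg (√(potential κ ν x) - G)
  rw [hint] at hnn
  refine ⟨by have := nonneg_of_mul_nonneg_right hnn hG; linarith, fun heq x => ?_⟩
  have h0 : ∫ x, (√(potential κ ν x) - G) ^ 2 = 0 := by rw [hint, heq]; ring
  by_contra hne
  have hpos := hc.integral_pos_of_hasCompactSupport_nonneg_nonzero (μ := volume)
    (HasCompactSupport.of_compactSpace _) (fun y => sq_nonneg (√(potential κ ν y) - G)) (x := x) (by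
      intro h
      have : √(potential κ ν x) = G := by nlinarith
      exact hne (by rw [← this, Real.sq_sqrt (potential_nonneg x)]))
  exact hpos.ne' h0

end

theorem isTorusBarycenter_iff (hκ : 0 < κ) (ν : FiniteMeasure (UnitAddTorus (Fin d))) :
    IsTorusBarycenter κ ν ↔
      ∀ x, potential κ (ν : Measure (UnitAddTorus (Fin d))) x = meanKernel κ d ^ 2 := by
  have hG := meanKernel_pos (d := d) hκ
  have hlow : ∀ ν : FiniteMeasure (UnitAddTorus (Fin d)),
      ENNReal.ofReal (1 - meanKernel κ d)
        ≤ hkObjective torusDist κ volume (ν : Measure (UnitAddTorus (Fin d))) := fun ν => by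
    refine le_trans (ENNReal.ofReal_le_ofReal ?_)
      (ofReal_le_hkObjective (ν := (ν : Measure (UnitAddTorus (Fin d)))) hκ)
    have := (two_mul_integral_sqrt_potential_le
      (ν := (ν : Measure (UnitAddTorus (Fin d)))) hκ).1
    linarith
  constructor
  · intro h
    let ν₀ : FiniteMeasure (UnitAddTorus (Fin d)) :=
      ⟨(meanKernel κ d).toNNReal • volume, inferInstance⟩
    have h0 : ∀ x, potential κ (ν₀ : Measure (UnitAddTorus (Fin d))) x = meanKernel κ d ^ 2 := by
      intro x
      change ∫ y, cosKernel κ (torusDist x y) ∂((meanKernel κ d).toNNReal • volume) = _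
      rw [integral_smul_nnreal_measure, integral_cosKernel_right, NNReal.smul_def,
        Real.coe_toNNReal _ hG.le, smul_eq_mul, sq]
    have h1 := (ofReal_le_hkObjective (ν := (ν : Measure (UnitAddTorus (Fin d)))) hκ).trans
      ((h ν₀).trans (hkObjective_le_of_potential_eq hκ h0))
    have h2 := two_mul_integral_sqrt_potential_le (ν := (ν : Measure (UnitAddTorus (Fin d)))) hκ
    refine h2.2 (le_antisymm h2.1 ?_)
    -- Ensures that `ENNReal.ofReal` does not truncate 1 - G, so the comparison passes to real
    -- numbers.
    have hG1 : meanKernel κ d ≤ 1 := by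
      have := potential_le (κ := κ) (ν := volume) (0 : UnitAddTorus (Fin d))
      rwa [potential, integral_cosKernel_right, probReal_univ] at this
    rw [ENNReal.ofReal_le_ofReal_iff (by linarith)] at h1
    linarith
  · exact fun h ν' => (hkObjective_le_of_potential_eq hκ h).trans (hlow ν')

theorem exists_atom_of_isDiscreteMeasure {X : Type*} [MeasurableSpace X] {ν : Measure X}
    (hd : IsDiscreteMeasure ν) (h0 : ν ≠ 0) : ∃ y, ν {y} ≠ 0 := by
  obtain ⟨S, hS, hS0⟩ := hd
  by_contra! h
  have h1 : ν S = 0 := by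
    rw [← Set.biUnion_of_singleton S]
    exact (measure_biUnion_null_iff hS).mpr fun y _ => h y
  refine h0 (Measure.measure_univ_eq_zero.mp ?_)
  rw [← Set.union_compl_self S]
  exact measure_union_null h1 hS0

theorem ne_zero_of_potential_eq (hκ : 0 < κ) {ν : Measure (UnitAddTorus (Fin d))}
    (h : ∀ x, potential κ ν x = meanKernel κ d ^ 2) : ν ≠ 0 := by
  rintro rfl
  have := h 0
  have hG := meanKernel_pos (d := d) hκ
  simp only [potential, integral_zero_measure] at this
  exact (pow_pos hG 2).ne this

end

open Filter Topology

/-! ### Regularity of the radial kernel along a line -/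

section
variable {κ : ℝ}

/-- The line lies at distance |s| from the centre. With r = √(t² + s²), the second derivative is the
average, with weights t²/r² and s²/r², of -(2/κ²) cos (2r/κ) and -sin (2r/κ)/(κ r), both at most
2/κ² in size. Its nonzero value at r = κπ/2 is the later source of the jump. -/
theorem exists_deriv_cos_sq_radial (hκ : 0 < κ) (s : ℝ) : ∃ f₁ f₂ : ℝ → ℝ,
    (∀ t, HasDerivAt (fun t => Real.cos (√(t ^ 2 + s ^ 2) / κ) ^ 2) (f₁ t) t) ∧
    (∀ t, HasDerivAt f₁ (f₂ t) t) ∧ (∀ t, |f₂ t| ≤ 2 / κ ^ 2) ∧ f₁ 0 = 0 ∧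
    (∀ t, √(t ^ 2 + s ^ 2) = κ * Real.pi / 2 →
      f₁ t = 0 ∧ f₂ t = 2 * t ^ 2 / (κ ^ 2 * (κ * Real.pi / 2) ^ 2)) ∧
    (s = 0 → ∀ t, f₁ t = -Real.sin (2 * (t / κ)) / κ) := by
  have hR : 0 < κ * Real.pi / 2 := by have := Real.pi_pos; positivity
  have hRκ : 2 * (κ * Real.pi / 2 / κ) = Real.pi := by field_simp
  rcases eq_or_ne s 0 with rfl | hs
  -- Through the centre the radius is |t|, not smooth at 0; evenness of the cosine removes the
  -- absolute value.
  · refine ⟨fun t => -Real.sin (2 * (t / κ)) / κ, fun t => -(2 / κ ^ 2) * Real.cos (2 * (t / κ)),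
      fun t => ?_, fun t => ?_, fun t => ?_, by simp, fun t ht => ?_, fun _ _ => rfl⟩
    · have h : (fun t : ℝ => Real.cos (√(t ^ 2 + 0 ^ 2) / κ) ^ 2)
          = fun t => Real.cos (t / κ) ^ 2 := by
        funext t
        rw [zero_pow two_ne_zero, add_zero, Real.sqrt_sq_eq_abs, ← abs_of_pos hκ, ← abs_div,
          Real.cos_abs, abs_of_pos hκ]
      rw [h]
      refine ((((hasDerivAt_id t).div_const κ).cos).pow 2).congr_deriv ?_
      simp only [id, Real.sin_two_mul]; push_cast; ring
    · refine ((((((hasDerivAt_id t).div_const κ).const_mul 2).sin).neg).div_const κ).congr_deriv ?_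
      simp only [id]; ring
    · rw [abs_mul, abs_neg, abs_of_pos (by positivity : 0 < 2 / κ ^ 2)]
      exact mul_le_of_le_one_right (by positivity) (Real.abs_cos_le_one _)
    · rw [zero_pow two_ne_zero, add_zero, Real.sqrt_sq_eq_abs] at ht
      have h1 : |2 * (t / κ)| = Real.pi := by
        rw [abs_mul, abs_div, ht, abs_of_pos hκ, abs_two, hRκ]
      have h2 : t ^ 2 = (κ * Real.pi / 2) ^ 2 := by rw [← sq_abs, ht]
      constructor
      · rcases eq_or_eq_neg_of_abs_eq h1 with h | h <;> simp [h]
      · beta_reduce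
        rw [← Real.cos_abs, h1, Real.cos_pi, h2]; field_simp
  · have hr : ∀ t : ℝ, 0 < √(t ^ 2 + s ^ 2) := fun t => Real.sqrt_pos.mpr (by positivity)
    have hr2 : ∀ t : ℝ, √(t ^ 2 + s ^ 2) ^ 2 = t ^ 2 + s ^ 2 := fun t =>
      Real.sq_sqrt (by positivity)
    have hdr : ∀ t : ℝ, HasDerivAt (fun t => √(t ^ 2 + s ^ 2)) (t / √(t ^ 2 + s ^ 2)) t := by
      intro t
      refine ((((hasDerivAt_id t).pow 2).add_const (s ^ 2)).sqrt
        (by simp only [Pi.pow_apply, id]; positivity)).congr_deriv ?_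
      have := (hr t).ne'
      simp only [id, Pi.pow_apply]; field_simp; push_cast; ring
    refine ⟨fun t => -Real.sin (2 * (√(t ^ 2 + s ^ 2) / κ)) / κ * (t / √(t ^ 2 + s ^ 2)),
      fun t => -(2 / κ ^ 2) * Real.cos (2 * (√(t ^ 2 + s ^ 2) / κ)) * (t ^ 2 / (t ^ 2 + s ^ 2))
        - Real.sin (2 * (√(t ^ 2 + s ^ 2) / κ)) / κ / √(t ^ 2 + s ^ 2)
          * (s ^ 2 / (t ^ 2 + s ^ 2)),
      fun t => ?_, fun t => ?_, fun t => ?_, by simp, fun t ht => ?_, fun h => absurd h hs⟩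
    · refine ((((hdr t).div_const κ).cos).pow 2).congr_deriv ?_
      simp only [Real.sin_two_mul]; push_cast; ring
    · refine ((((((hdr t).div_const κ).const_mul 2).sin).neg.div_const κ).mul
        ((hasDerivAt_id t).div (hdr t) (hr t).ne')).congr_deriv ?_
      have h1 := (hr t).ne'
      have h2 := hr2 t
      have h3 : (t ^ 2 + s ^ 2) ≠ 0 := by positivity
      simp only [id, Pi.div_apply, Pi.neg_apply]
      rw [h2]
      generalize √(t ^ 2 + s ^ 2) = r at *
      rw [← h2] at h3 ⊢
      have h4 : s ^ 2 = r ^ 2 - t ^ 2 := by linarith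
      rw [h4]
      field_simp
      ring
    · have h1 : |Real.cos (2 * (√(t ^ 2 + s ^ 2) / κ))| ≤ 1 := Real.abs_cos_le_one _
      have h2 : |Real.sin (2 * (√(t ^ 2 + s ^ 2) / κ)) / κ / √(t ^ 2 + s ^ 2)| ≤ 2 / κ ^ 2 := by
        rw [abs_div, abs_div, abs_of_pos hκ, abs_of_pos (hr t), div_div, div_le_iff₀
          (mul_pos hκ (hr t))]
        have h0 : 0 ≤ 2 * (√(t ^ 2 + s ^ 2) / κ) := by have := hr t; positivity
        refine (Real.abs_sin_le_abs).trans ?_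
        rw [abs_of_nonneg h0]
        apply le_of_eq; field_simp
      have h3 : 0 < t ^ 2 + s ^ 2 := by positivity
      have ha : 0 ≤ t ^ 2 / (t ^ 2 + s ^ 2) := by positivity
      have hb : 0 ≤ s ^ 2 / (t ^ 2 + s ^ 2) := by positivity
      have hab : t ^ 2 / (t ^ 2 + s ^ 2) + s ^ 2 / (t ^ 2 + s ^ 2) = 1 := by field_simp
      have hc : 0 < 2 / κ ^ 2 := by positivity
      refine (abs_sub _ _).trans ?_
      rw [abs_mul, abs_mul, abs_mul, abs_neg, abs_of_pos hc, abs_of_nonneg ha, abs_of_nonneg hb]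
      calc _ ≤ 2 / κ ^ 2 * 1 * (t ^ 2 / (t ^ 2 + s ^ 2)) + 2 / κ ^ 2 * (s ^ 2 / (t ^ 2 + s ^ 2)) := by
            gcongr
        _ = 2 / κ ^ 2 := by rw [mul_one, ← mul_add, hab, mul_one]
    · have h2 := hr2 t
      rw [ht] at h2
      simp only [ht, hRκ, Real.sin_pi, Real.cos_pi]
      rw [← h2]
      constructor
      · simp
      · field_simp; ring

/-- The derivative is `f₁` precomposed with clamping to the chord [-b, b] on which the radius is at
most R. As `f₁` vanishes at ±b, this is 0 outside, and clamping preserves the Lipschitz constant. -/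
theorem exists_deriv_cosKernel_radial (hκ : 0 < κ) (s : ℝ) : ∃ p : ℝ → ℝ,
    (∀ t, HasDerivAt (fun t => cosKernel κ √(t ^ 2 + s ^ 2)) (p t) t) ∧
    (∀ t u, |p t - p u| ≤ 2 / κ ^ 2 * |t - u|) ∧
    (∀ t, √(t ^ 2 + s ^ 2) ≠ κ * Real.pi / 2 → DifferentiableAt ℝ p t) ∧
    (∀ t, 0 < t → √(t ^ 2 + s ^ 2) = κ * Real.pi / 2 → HasDerivWithinAt p 0 (Set.Ici t) t ∧
      HasDerivWithinAt p (2 * t ^ 2 / (κ ^ 2 * (κ * Real.pi / 2) ^ 2)) (Set.Iic t) t) ∧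
    (s = 0 → ∀ t, |t| < κ * Real.pi / 2 → p t = -Real.sin (2 * (t / κ)) / κ) := by
  obtain ⟨f₁, f₂, hf, hf₁, hf₂, h0, hb, hs0⟩ := exists_deriv_cos_sq_radial hκ s
  have hR : 0 < κ * Real.pi / 2 := by have := Real.pi_pos; positivity
  set R := κ * Real.pi / 2 with hRdef
  set b := √(R ^ 2 - s ^ 2) with hbdef
  have hb0 : 0 ≤ b := Real.sqrt_nonneg _
  have hcont : Continuous fun t : ℝ => √(t ^ 2 + s ^ 2) := by fun_prop
  have habs : ∀ t : ℝ, √(t ^ 2 + s ^ 2) < R ↔ |t| < b := by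
    intro t
    rw [Real.sqrt_lt' hR, Real.lt_sqrt (abs_nonneg t), sq_abs, lt_sub_iff_add_lt]
  have hfb : f₁ b = 0 ∧ f₁ (-b) = 0 := by
    rcases le_total (s ^ 2) (R ^ 2) with h | h
    · have hbs : b ^ 2 + s ^ 2 = R ^ 2 := by rw [Real.sq_sqrt (by linarith)]; ring
      refine ⟨(hb b ?_).1, (hb (-b) ?_).1⟩
      · rw [hbs, Real.sqrt_sq hR.le]
      · rw [neg_sq, hbs, Real.sqrt_sq hR.le]
    -- If the line misses the ball, the square root defaults to b = 0, and the clamped function is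
    -- constantly `f₁ 0 = 0`.
    · have : b = 0 := Real.sqrt_eq_zero_of_nonpos (by linarith)
      rw [this, neg_zero]; exact ⟨h0, h0⟩
  have hin : ∀ t, |t| ≤ b → f₁ (max (-b) (min t b)) = f₁ t := by
    intro t ht
    rw [min_eq_left (abs_le.mp ht).2, max_eq_right (abs_le.mp ht).1]
  have hout : ∀ t, b ≤ |t| → f₁ (max (-b) (min t b)) = 0 := by
    intro t ht
    rcases le_abs.mp ht with h | h
    · rw [min_eq_right h, max_eq_right (by linarith)]; exact hfb.1
    · rw [min_eq_left (by linarith), max_eq_left (by linarith)]; exact hfb.2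
  refine ⟨fun t => f₁ (max (-b) (min t b)), fun t => ?_, fun t u => ?_, fun t ht => ?_,
    fun t ht htR => ?_, fun hs t ht => ?_⟩
  · rcases lt_trichotomy (√(t ^ 2 + s ^ 2)) R with h | h | h
    · beta_reduce; rw [hin t ((habs t).mp h).le]
      refine (hf t).congr_of_eventuallyEq ?_
      filter_upwards [hcont.continuousAt.eventually_lt continuousAt_const h] with u hu
      exact cosKernel_of_lt hu
    · have hbt : b ≤ |t| := not_lt.mp fun h' => h.not_lt ((habs t).mpr h')
      beta_reduce
      rw [hout t hbt]
      have hft := hf t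
      rw [(hb t h).1] at hft
      have hz : cosKernel κ √(t ^ 2 + s ^ 2) = 0 := cosKernel_of_le hκ h.ge
      have hz' : Real.cos (√(t ^ 2 + s ^ 2) / κ) ^ 2 = 0 := by
        have : R / κ = Real.pi / 2 := by rw [hRdef]; field_simp
        rw [h, this, Real.cos_pi_div_two]; norm_num
      rw [hasDerivAt_iff_isLittleO] at hft ⊢
      simp only [smul_zero, sub_zero, hz, hz'] at hft ⊢
      -- On the sphere, the truncated kernel is dominated by cos², which vanishes there together
      -- with its derivative.
      refine Asymptotics.IsBigO.trans_isLittleO (Asymptotics.IsBigO.of_bound 1 ?_) hft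
      refine Eventually.of_forall fun u => ?_
      rw [one_mul]
      rcases lt_or_ge (√(u ^ 2 + s ^ 2)) R with hu | hu
      · rw [cosKernel_of_lt hu]
      · rw [cosKernel_of_le hκ hu, norm_zero]; exact norm_nonneg _
    · have hbt : b ≤ |t| := not_lt.mp fun h' => h.not_gt ((habs t).mpr h')
      beta_reduce
      rw [hout t hbt]
      refine (hasDerivAt_const t (0 : ℝ)).congr_of_eventuallyEq ?_
      filter_upwards [continuousAt_const.eventually_lt hcont.continuousAt h] with u hu
      exact cosKernel_of_le hκ hu.le
  · have hlip := Convex.norm_image_sub_le_of_norm_hasDerivWithin_le (f := f₁) (f' := f₂)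
      (s := Set.univ) (C := 2 / κ ^ 2) (fun x _ => (hf₁ x).hasDerivWithinAt) (fun x _ => hf₂ x)
      convex_univ (Set.mem_univ (max (-b) (min u b))) (Set.mem_univ (max (-b) (min t b)))
    refine hlip.trans ?_
    gcongr
    refine (abs_max_sub_max_le_max _ _ _ _).trans (max_le (by simp) ?_)
    exact (abs_min_sub_min_le_max _ _ _ _).trans (max_le le_rfl (by simp))
  · rcases lt_or_gt_of_ne ht with h | h
    · refine ((hf₁ t).differentiableAt).congr_of_eventuallyEq ?_
      filter_upwards [hcont.continuousAt.eventually_lt continuousAt_const h] with u hu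
      exact hin u ((habs u).mp hu).le
    · refine (differentiableAt_const (0 : ℝ)).congr_of_eventuallyEq ?_
      filter_upwards [continuousAt_const.eventually_lt hcont.continuousAt h] with u hu
      exact hout u (not_lt.mp fun h' => hu.not_gt ((habs u).mpr h'))
  · have htb : t = b := by
      have h1 : t ^ 2 + s ^ 2 = R ^ 2 := by
        rw [← htR, Real.sq_sqrt (by positivity)]
      rw [hbdef, ← h1, add_sub_cancel_right, Real.sqrt_sq ht.le]
    constructor
    · refine (hasDerivWithinAt_const t (Set.Ici t) (0 : ℝ)).congr (fun u hu => ?_) ?_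
      · exact hout u (htb ▸ (le_trans (Set.mem_Ici.mp hu) (le_abs_self u)))
      · exact hout t (htb ▸ le_abs_self t)
    · rw [← (hb t htR).2]
      refine (hf₁ t).hasDerivWithinAt.congr_of_eventuallyEq ?_
        (hin t (by rw [abs_of_pos ht, htb]))
      have : ∀ᶠ u in 𝓝[Set.Iic t] t, 0 < u := nhdsWithin_le_nhds (lt_mem_nhds ht)
      filter_upwards [this, self_mem_nhdsWithin] with u hu hut
      exact hin u (by rw [abs_of_pos hu, ← htb]; exact hut)
  · rw [← hs0 hs]
    refine hin t ((habs t).mp ?_).le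
    rw [hs, zero_pow two_ne_zero, add_zero, Real.sqrt_sq_eq_abs]
    exact ht

end

/-! ### Third differences as detectors of jumps of the second derivative -/

/-- An odd third order difference of `f` at `t`; it annihilates quadratic polynomials. -/
def thirdDiff (f : ℝ → ℝ) (t h : ℝ) : ℝ :=
  f (t + 3 * h) - 3 * f (t + h) + 3 * f (t - h) - f (t - 3 * h)

theorem abs_sub_sub_mul_le_of_deriv_lipschitz {f p : ℝ → ℝ} {K : ℝ}
    (hf : ∀ u, HasDerivAt f (p u) u) (hp : ∀ t u, |p t - p u| ≤ K * |t - u|) (t h : ℝ) :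
    |f (t + h) - f t - p t * h| ≤ K * h ^ 2 := by
  have hK : 0 ≤ K := by simpa using (abs_nonneg _).trans (hp 1 0)
  have hd : ∀ u, HasDerivAt (fun u => f (t + u) - p t * u) (p (t + u) - p t) u := fun u => by
    have h1 := (hf (t + u)).comp_const_add t u
    exact (h1.sub ((hasDerivAt_id u).const_mul (p t))).congr_deriv (by simp)
  have := Convex.norm_image_sub_le_of_norm_hasDerivWithin_le (C := K * |h|) (s := Set.uIcc 0 h)
    (fun u _ => (hd u).hasDerivWithinAt) (fun u hu => by
      refine (hp _ _).trans ?_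
      have : |u| ≤ |h| := by simpa using Set.abs_sub_left_of_mem_uIcc hu
      rw [add_sub_cancel_left]; gcongr)
    (convex_uIcc 0 h) Set.left_mem_uIcc Set.right_mem_uIcc
  simp only [Real.norm_eq_abs, add_zero, mul_zero, sub_zero] at this
  rw [mul_assoc, abs_mul_abs_self, ← sq] at this
  convert this using 2
  ring

theorem tendsto_taylor_right {f p : ℝ → ℝ} {t r : ℝ} (hf : ∀ u, HasDerivAt f (p u) u)
    (hp : HasDerivWithinAt p r (Set.Ici t) t) :
    Tendsto (fun h => (f (t + h) - f t - p t * h) / h ^ 2) (𝓝[>] 0) (𝓝 (r / 2)) := by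
  rw [Metric.tendsto_nhdsWithin_nhds]
  intro ε hε
  rw [hasDerivWithinAt_iff_isLittleO, Asymptotics.isLittleO_iff] at hp
  obtain ⟨δ, hδ, hδ'⟩ := Metric.mem_nhdsWithin_iff.mp (hp (half_pos hε))
  refine ⟨δ, hδ, fun {h} hh hhδ => ?_⟩
  rw [Set.mem_Ioi] at hh
  rw [Real.dist_eq, sub_zero, abs_of_pos hh] at hhδ
  have hd : ∀ u, HasDerivAt (fun u => f (t + u) - p t * u - r / 2 * u ^ 2)
      (p (t + u) - p t - r * u) u := fun u => by
    have h1 := ((hf (t + u)).comp_const_add t u).sub ((hasDerivAt_id u).const_mul (p t))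
    refine (h1.sub ((hasDerivAt_pow 2 u).const_mul (r / 2))).congr_deriv ?_
    push_cast; ring
  have := Convex.norm_image_sub_le_of_norm_hasDerivWithin_le (C := ε / 2 * h) (s := Set.Icc 0 h)
    (fun u _ => (hd u).hasDerivWithinAt) (fun u hu => by
      have hmem : t + u ∈ Metric.ball t δ ∩ Set.Ici t := by
        constructor
        · rw [Metric.mem_ball, Real.dist_eq, add_sub_cancel_left, abs_of_nonneg hu.1]
          exact hu.2.trans_lt hhδ
        · exact le_add_of_nonneg_right hu.1
      have h2 := hδ' hmem
      simp only [Set.mem_ofPred_eq, add_sub_cancel_left, smul_eq_mul] at h2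
      rw [mul_comm r]
      refine h2.trans ?_
      rw [Real.norm_eq_abs, abs_of_nonneg hu.1]
      have := hu.2
      gcongr)
    (convex_Icc 0 h) (Set.left_mem_Icc.mpr hh.le) (Set.right_mem_Icc.mpr hh.le)
  simp only [Real.norm_eq_abs, add_zero, mul_zero, sub_zero, abs_of_pos hh,
    zero_pow two_ne_zero] at this
  have h2 : 0 < h ^ 2 := by positivity
  have e : (f (t + h) - f t - p t * h) / h ^ 2 - r / 2
      = (f (t + h) - p t * h - r / 2 * h ^ 2 - f t) / h ^ 2 := by field_simp; ring
  rw [Real.dist_eq, e, abs_div, abs_of_pos h2, div_lt_iff₀ h2]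
  nlinarith

theorem tendsto_taylor_left {f p : ℝ → ℝ} {t l : ℝ} (hf : ∀ u, HasDerivAt f (p u) u)
    (hp : HasDerivWithinAt p l (Set.Iic t) t) :
    Tendsto (fun h => (f (t - h) - f t + p t * h) / h ^ 2) (𝓝[>] 0) (𝓝 (l / 2)) := by
  have hf' : ∀ u, HasDerivAt (fun u => f (-u)) (-p (-u)) u := fun u => by
    exact ((hf (-u)).scomp u (hasDerivAt_neg u)).congr_deriv (by simp)
  have hp' : HasDerivWithinAt (fun u => -p (-u)) l (Set.Ici (-t)) (-t) := by
    have hp0 : HasDerivWithinAt p l (Set.Iic t) (-(-t)) := by rwa [neg_neg]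
    have := (HasDerivWithinAt.scomp (-t) hp0 (hasDerivAt_neg (-t)).hasDerivWithinAt
      (s := Set.Ici (-t)) (fun u hu => by
        simp only [Set.mem_Ici, Set.mem_Iic] at *; linarith)).neg
    exact this.congr_deriv (by simp)
  refine (tendsto_taylor_right hf' hp').congr fun h => ?_
  simp only [neg_add, neg_neg, ← sub_eq_add_neg, neg_mul, sub_neg_eq_add]

/-- Values and first derivatives cancel. The one-sided quadratic terms leave (9 - 3) r/2 from the
right and (3 - 9) l/2 from the left. -/
theorem tendsto_thirdDiff_div_sq {f p : ℝ → ℝ} {t r l : ℝ} (hf : ∀ u, HasDerivAt f (p u) u)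
    (hr : HasDerivWithinAt p r (Set.Ici t) t) (hl : HasDerivWithinAt p l (Set.Iic t) t) :
    Tendsto (fun h => thirdDiff f t h / h ^ 2) (𝓝[>] 0) (𝓝 (3 * (r - l))) := by
  have h3 : Tendsto (fun h : ℝ => 3 * h) (𝓝[>] 0) (𝓝[>] 0) := by
    refine tendsto_nhdsWithin_iff.mpr ⟨?_, ?_⟩
    · have : Tendsto (fun h : ℝ => 3 * h) (𝓝 0) (𝓝 (3 * 0)) :=
        (continuous_const.mul continuous_id).tendsto 0
      rw [mul_zero] at this
      exact this.mono_left nhdsWithin_le_nhds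
    · filter_upwards [self_mem_nhdsWithin] with h hh
      rw [Set.mem_Ioi] at *; linarith
  have hR := tendsto_taylor_right hf hr
  have hL := tendsto_taylor_left hf hl
  have := (((hR.comp h3).const_mul 9).sub (hR.const_mul 3)).add
    ((hL.const_mul 3).sub ((hL.comp h3).const_mul 9))
  rw [show 9 * (r / 2) - 3 * (r / 2) + (3 * (l / 2) - 9 * (l / 2)) = 3 * (r - l) by ring] at this
  refine this.congr' ?_
  filter_upwards [self_mem_nhdsWithin] with h hh
  have : h ≠ 0 := (Set.mem_Ioi.mp hh).ne'
  simp only [Function.comp, thirdDiff]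
  field_simp
  ring

theorem abs_thirdDiff_le {f p : ℝ → ℝ} {K : ℝ}
    (hf : ∀ u, HasDerivAt f (p u) u) (hp : ∀ t u, |p t - p u| ≤ K * |t - u|) (t h : ℝ) :
    |thirdDiff f t h| ≤ 24 * K * h ^ 2 := by
  have h1 := abs_le.mp (abs_sub_sub_mul_le_of_deriv_lipschitz hf hp t h)
  have h2 := abs_le.mp (abs_sub_sub_mul_le_of_deriv_lipschitz hf hp t (-h))
  have h3 := abs_le.mp (abs_sub_sub_mul_le_of_deriv_lipschitz hf hp t (3 * h))
  have h4 := abs_le.mp (abs_sub_sub_mul_le_of_deriv_lipschitz hf hp t (-(3 * h)))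
  -- The constant 24 is 9 + 3 + 3 + 9, the weighted sum of the four Taylor remainders.
  rw [← sub_eq_add_neg] at h2 h4
  rw [thirdDiff, abs_le]
  constructor <;> nlinarith

theorem thirdDiff_neg_of_even {f : ℝ → ℝ} (hf : ∀ t, f (-t) = f t) (t h : ℝ) :
    thirdDiff f (-t) h = -thirdDiff f t h := by
  have e : ∀ a, f (-t + a) = f (t - a) := fun a => by rw [← hf]; congr 1; ring
  have e' : ∀ a, f (-t - a) = f (t + a) := fun a => by rw [← hf]; congr 1; ring
  simp only [thirdDiff, e, e']; ring

/-! ### Wrapping the kernel around the circle when κπ ≤ 1 -/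

section
variable {κ : ℝ}

/-- Here R ≤ 1/2, so the line kernel vanishes for |u| ≥ 1/2 and the circle kernel is its
periodisation. Three translates suffice for |t| ≤ 1; in third differences this is the reason for h ≤
1/6. -/
theorem cosKernel_unitAddCircle (hκ : 0 < κ) (h1 : κ * Real.pi ≤ 1) (s : ℝ) {t : ℝ}
    (ht : |t| ≤ 1) :
    cosKernel κ √(‖(t : UnitAddCircle)‖ ^ 2 + s ^ 2) = cosKernel κ √((t - 1) ^ 2 + s ^ 2)
      + cosKernel κ √(t ^ 2 + s ^ 2) + cosKernel κ √((t + 1) ^ 2 + s ^ 2) := by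
  have hz : ∀ u : ℝ, 1 / 2 ≤ |u| → cosKernel κ √(u ^ 2 + s ^ 2) = 0 := fun u hu => by
    refine cosKernel_of_le hκ ?_
    calc κ * Real.pi / 2 ≤ |u| := by linarith
      _ ≤ √(u ^ 2 + s ^ 2) := Real.abs_le_sqrt (by nlinarith [sq_nonneg s])
  have hn : ∀ u : ℝ, |u| ≤ 1 / 2 → ‖(u : UnitAddCircle)‖ ^ 2 = u ^ 2 := fun u hu => by
    rw [(AddCircle.norm_coe_eq_abs_iff 1 one_ne_zero).mpr (by simpa using hu), sq_abs]
  have hper : ‖((t - 1 : ℝ) : UnitAddCircle)‖ = ‖(t : UnitAddCircle)‖ ∧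
      ‖((t + 1 : ℝ) : UnitAddCircle)‖ = ‖(t : UnitAddCircle)‖ := by
    simp [AddCircle.coe_period]
  obtain ⟨ha, hb⟩ := abs_le.mp ht
  rcases lt_or_ge (1 / 2) t with h | h
  · rw [← hper.1, hn (t - 1) (abs_le.mpr ⟨by linarith, by linarith⟩),
      hz t (le_abs.mpr (Or.inl h.le)), hz (t + 1) (le_abs.mpr (Or.inl (by linarith)))]
    ring
  rcases lt_or_ge t (-(1 / 2)) with h' | h'
  · rw [← hper.2, hn (t + 1) (abs_le.mpr ⟨by linarith, by linarith⟩),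
      hz t (le_abs.mpr (Or.inr (by linarith))), hz (t - 1) (le_abs.mpr (Or.inr (by linarith)))]
    ring
  · rw [hn t (abs_le.mpr ⟨h', h⟩), hz (t - 1) (le_abs.mpr (Or.inr (by linarith))),
      hz (t + 1) (le_abs.mpr (Or.inl (by linarith)))]
    ring

theorem thirdDiff_unitAddCircle (hκ : 0 < κ) (h1 : κ * Real.pi ≤ 1) (s : ℝ) {t h : ℝ}
    (ht : |t| ≤ 1 / 2) (hh : 0 < h) (hh' : h ≤ 1 / 6) :
    thirdDiff (fun t => cosKernel κ √(‖(t : UnitAddCircle)‖ ^ 2 + s ^ 2)) t h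
      = thirdDiff (fun t => cosKernel κ √(t ^ 2 + s ^ 2)) (t - 1) h
        + thirdDiff (fun t => cosKernel κ √(t ^ 2 + s ^ 2)) t h
        + thirdDiff (fun t => cosKernel κ √(t ^ 2 + s ^ 2)) (t + 1) h := by
  obtain ⟨ha, hb⟩ := abs_le.mp ht
  simp only [thirdDiff]
  rw [cosKernel_unitAddCircle hκ h1 s (t := t + 3 * h) (abs_le.mpr ⟨by linarith, by linarith⟩),
    cosKernel_unitAddCircle hκ h1 s (t := t + h) (abs_le.mpr ⟨by linarith, by linarith⟩),
    cosKernel_unitAddCircle hκ h1 s (t := t - h) (abs_le.mpr ⟨by linarith, by linarith⟩),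
    cosKernel_unitAddCircle hκ h1 s (t := t - 3 * h) (abs_le.mpr ⟨by linarith, by linarith⟩)]
  rw [show t + 3 * h - 1 = t - 1 + 3 * h by ring, show t + h - 1 = t - 1 + h by ring,
    show t - 3 * h - 1 = t - 1 - 3 * h by ring, show t - h - 1 = t - 1 - h by ring,
    show t + 3 * h + 1 = t + 1 + 3 * h by ring, show t + h + 1 = t + 1 + h by ring,
    show t - 3 * h + 1 = t + 1 - 3 * h by ring, show t - h + 1 = t + 1 - h by ring]
  ring

theorem abs_thirdDiff_unitAddCircle_le (hκ : 0 < κ) (h1 : κ * Real.pi ≤ 1) (s : ℝ) {t h : ℝ}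
    (ht : |t| ≤ 1 / 2) (hh : 0 < h) (hh' : h ≤ 1 / 6) :
    |thirdDiff (fun t => cosKernel κ √(‖(t : UnitAddCircle)‖ ^ 2 + s ^ 2)) t h|
      ≤ 3 * (24 * (2 / κ ^ 2) * h ^ 2) := by
  obtain ⟨p, hp, hlip, -⟩ := exists_deriv_cosKernel_radial hκ s
  rw [thirdDiff_unitAddCircle hκ h1 s ht hh hh']
  refine (abs_add_three _ _ _).trans ?_
  linarith [abs_thirdDiff_le hp hlip (t - 1) h, abs_thirdDiff_le hp hlip t h,
    abs_thirdDiff_le hp hlip (t + 1) h]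

theorem tendsto_thirdDiff_radial_of_ne (hκ : 0 < κ) {s t : ℝ}
    (hne : √(t ^ 2 + s ^ 2) ≠ κ * Real.pi / 2) :
    Tendsto (fun h => thirdDiff (fun t => cosKernel κ √(t ^ 2 + s ^ 2)) t h / h ^ 2)
      (𝓝[>] 0) (𝓝 0) := by
  obtain ⟨p, hp, -, hdiff, -⟩ := exists_deriv_cosKernel_radial hκ s
  have hd := (hdiff t hne).hasDerivAt
  simpa using tendsto_thirdDiff_div_sq hp hd.hasDerivWithinAt hd.hasDerivWithinAt

theorem tendsto_thirdDiff_radial_of_pos (hκ : 0 < κ) {s t : ℝ} (ht : 0 < t)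
    (he : √(t ^ 2 + s ^ 2) = κ * Real.pi / 2) :
    Tendsto (fun h => thirdDiff (fun t => cosKernel κ √(t ^ 2 + s ^ 2)) t h / h ^ 2)
      (𝓝[>] 0) (𝓝 (-(6 * t ^ 2 / (κ ^ 2 * (κ * Real.pi / 2) ^ 2)))) := by
  obtain ⟨p, hp, -, -, hjump, -⟩ := exists_deriv_cosKernel_radial hκ s
  obtain ⟨hr, hl⟩ := hjump t ht he
  convert tendsto_thirdDiff_div_sq hp hr hl using 2
  ring

/-- A neighbouring translate has |u| ≥ 1/2 ≥ R, so it meets the sphere only if |u| = |t| = 1/2,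
where t would meet it too. Hence in the cases considered neighbouring translates add no jump. -/
theorem sqrt_sq_add_sq_ne (hκ : 0 < κ) (h1 : κ * Real.pi ≤ 1) {s t u : ℝ} (ht : |t| ≤ 1 / 2)
    (hu : |u| = 1 - |t|)
    (h : |t| < 1 / 2 ∨ √(t ^ 2 + s ^ 2) ≠ κ * Real.pi / 2) :
    √(u ^ 2 + s ^ 2) ≠ κ * Real.pi / 2 := by
  intro he
  have hπ := mul_pos hκ Real.pi_pos
  have hle : |u| ≤ κ * Real.pi / 2 := he ▸ Real.abs_le_sqrt (by nlinarith [sq_nonneg s])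
  rcases h with h | h
  · linarith
  · have htu : |t| = |u| := by linarith
    have : t ^ 2 = u ^ 2 := (sq_eq_sq_iff_abs_eq_abs t u).mpr htu
    exact h (by rw [this, he])

theorem tendsto_thirdDiff_unitAddCircle (hκ : 0 < κ) (h1 : κ * Real.pi ≤ 1) {s t j : ℝ}
    (ht : |t| ≤ 1 / 2) (h : |t| < 1 / 2 ∨ √(t ^ 2 + s ^ 2) ≠ κ * Real.pi / 2)
    (hj : Tendsto (fun h => thirdDiff (fun t => cosKernel κ √(t ^ 2 + s ^ 2)) t h / h ^ 2)
      (𝓝[>] 0) (𝓝 j)) :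
    Tendsto (fun h => thirdDiff
      (fun t => cosKernel κ √(‖(t : UnitAddCircle)‖ ^ 2 + s ^ 2)) t h / h ^ 2)
      (𝓝[>] 0) (𝓝 j) := by
  have hz : ∀ u, |u| = 1 - |t| → Tendsto (fun h => thirdDiff
      (fun t => cosKernel κ √(t ^ 2 + s ^ 2)) u h / h ^ 2) (𝓝[>] 0) (𝓝 0) := fun u hu =>
    tendsto_thirdDiff_radial_of_ne hκ (sqrt_sq_add_sq_ne hκ h1 ht hu h)
  have hz' : ∀ u, (|u| = 1 - |t| ∨ 1 ≤ |u|) → Tendsto (fun h => thirdDiff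
      (fun t => cosKernel κ √(t ^ 2 + s ^ 2)) u h / h ^ 2) (𝓝[>] 0) (𝓝 0) := by
    rintro u (hu | hu)
    · exact hz u hu
    · refine tendsto_thirdDiff_radial_of_ne hκ fun he => ?_
      have hle : |u| ≤ κ * Real.pi / 2 := he ▸ Real.abs_le_sqrt (by nlinarith [sq_nonneg s])
      linarith
  obtain ⟨ha, hb⟩ := abs_le.mp ht
  have hm : |t - 1| = 1 - t := by rw [abs_of_nonpos (by linarith)]; ring
  have hp : |t + 1| = 1 + t := by rw [abs_of_nonneg (by linarith)]; ring
  have hminus := hz' (t - 1) (by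
    rcases le_total 0 t with h0 | h0
    · left; rw [hm, abs_of_nonneg h0]
    · right; rw [hm]; linarith)
  have hplus := hz' (t + 1) (by
    rcases le_total 0 t with h0 | h0
    · right; rw [hp]; linarith
    · left; rw [hp, abs_of_nonpos h0]; ring)
  have := (hminus.add hj).add hplus
  rw [zero_add, add_zero] at this
  refine this.congr' ?_
  have hmem : Set.Ioo (0 : ℝ) (1 / 6) ∈ 𝓝[>] (0 : ℝ) := Ioo_mem_nhdsGT (by norm_num)
  filter_upwards [hmem] with h hh
  rw [thirdDiff_unitAddCircle hκ h1 s ht hh.1 hh.2.le]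
  ring

end

theorem exists_coe_eq_abs_le (z : UnitAddCircle) :
    ∃ t : ℝ, |t| ≤ 1 / 2 ∧ (t : UnitAddCircle) = z := by
  obtain ⟨u, rfl⟩ := QuotientAddGroup.mk_surjective z
  refine ⟨u - round u, abs_sub_round u, ?_⟩
  have : ((round u : ℝ) : UnitAddCircle) = 0 :=
    (AddCircle.coe_eq_zero_iff 1).mpr ⟨round u, by simp⟩
  rw [AddCircle.coe_sub, this, sub_zero]

theorem norm_unitAddCircle_sq {t : ℝ} (ht : |t| ≤ 1 / 2) : ‖(t : UnitAddCircle)‖ ^ 2 = t ^ 2 := by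
  rw [(AddCircle.norm_coe_eq_abs_iff 1 one_ne_zero).mpr (by simpa using ht), sq_abs]

theorem norm_unitAddCircle_le (t : ℝ) : ‖(t : UnitAddCircle)‖ ≤ |t| := by
  rw [UnitAddCircle.norm_eq]
  simpa using round_le t 0

/-! ### Differences along the first coordinate, and atoms when κπ > 1 -/

section
variable {n : ℕ} {κ : ℝ}

/-- The distance of `x` and `y` in all but the first coordinate. -/
noncomputable def tailDist (x y : UnitAddTorus (Fin (n + 1))) : ℝ :=
  √(∑ i : Fin n, dist (x i.succ) (y i.succ) ^ 2)

theorem torusDist_add_single {x y : UnitAddTorus (Fin (n + 1))} {t : ℝ}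
    (ht : (t : UnitAddCircle) = x 0 - y 0) (h : ℝ) :
    torusDist (x + Pi.single 0 (h : UnitAddCircle)) y
      = √(‖((t + h : ℝ) : UnitAddCircle)‖ ^ 2 + tailDist x y ^ 2) := by
  rw [torusDist, tailDist, Fin.sum_univ_succ, Real.sq_sqrt (Finset.sum_nonneg fun _ _ => sq_nonneg _)]
  congr 2
  · rw [dist_eq_norm, AddCircle.coe_add, ht]
    congr 2
    simp only [Pi.add_apply, Pi.single_eq_same]; abel
  · refine Finset.sum_congr rfl fun i _ => ?_
    rw [Pi.add_apply, Pi.single_eq_of_ne (Fin.succ_ne_zero i), add_zero]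

theorem torusDist_eq_sqrt {x y : UnitAddTorus (Fin (n + 1))} {t : ℝ}
    (ht : (t : UnitAddCircle) = x 0 - y 0) (ht' : |t| ≤ 1 / 2) :
    torusDist x y = √(t ^ 2 + tailDist x y ^ 2) := by
  have := torusDist_add_single ht 0
  rwa [AddCircle.coe_zero, Pi.single_zero, add_zero, add_zero, norm_unitAddCircle_sq ht'] at this

theorem cosKernel_anti (hκ : 0 < κ) {r r' : ℝ} (hr : 0 ≤ r) (h : r ≤ r') :
    cosKernel κ r' ≤ cosKernel κ r := by
  have hR : 0 < κ * Real.pi / 2 := by have := Real.pi_pos; positivity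
  have hup : ∀ u, min u (κ * Real.pi / 2) / κ ≤ Real.pi / 2 := fun u => by
    rw [div_le_iff₀ hκ]; linarith [min_le_right u (κ * Real.pi / 2)]
  have h0 : 0 ≤ min r (κ * Real.pi / 2) / κ := div_nonneg (le_min hr hR.le) hκ.le
  have hle : min r (κ * Real.pi / 2) / κ ≤ min r' (κ * Real.pi / 2) / κ := by gcongr
  have hπ := Real.pi_pos
  refine pow_le_pow_left₀ (Real.cos_nonneg_of_mem_Icc ⟨by linarith, hup _⟩) ?_ 2
  exact Real.cos_le_cos_of_nonneg_of_le_pi h0 (by linarith [hup r']) hle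

/-- Second differences of the kernel are bounded below by a quadratic term. -/
theorem neg_le_secondDiff_cosKernel (hκ : 0 < κ) (x y : UnitAddTorus (Fin (n + 1))) (h : ℝ) :
    -(2 * (2 / κ ^ 2) * h ^ 2) ≤
      cosKernel κ (torusDist (x + Pi.single 0 (h : UnitAddCircle)) y)
        + cosKernel κ (torusDist (x + Pi.single 0 ((-h : ℝ) : UnitAddCircle)) y)
        - 2 * cosKernel κ (torusDist x y) := by
  obtain ⟨t, ht, htxy⟩ := exists_coe_eq_abs_le (x 0 - y 0)
  obtain ⟨p, hp, hlip, -⟩ := exists_deriv_cosKernel_radial hκ (tailDist x y)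
  rw [torusDist_add_single htxy, torusDist_add_single htxy, torusDist_eq_sqrt htxy ht]
  -- The circle norm is at most |u| and the kernel decreases, so the periodic kernel lies above the
  -- line kernel, with equality at the base point. The C^{1,1} bound on the line thus survives as a
  -- one-sided bound.
  have hmono : ∀ u : ℝ, cosKernel κ √(u ^ 2 + tailDist x y ^ 2)
      ≤ cosKernel κ √(‖(u : UnitAddCircle)‖ ^ 2 + tailDist x y ^ 2) := fun u => by
    refine cosKernel_anti hκ (Real.sqrt_nonneg _) (Real.sqrt_le_sqrt ?_)
    have := pow_le_pow_left₀ (norm_nonneg _) (norm_unitAddCircle_le u) 2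
    rw [sq_abs] at this
    linarith
  have h1 := abs_le.mp (abs_sub_sub_mul_le_of_deriv_lipschitz hp hlip t h)
  have h2 := abs_le.mp (abs_sub_sub_mul_le_of_deriv_lipschitz hp hlip t (-h))
  have h3 := hmono (t + h)
  have h4 := hmono (t + -h)
  nlinarith

/-- Moving by ±h from the antipode gives distance 1/2 - h either way. As R > 1/2, the kernel still
has slope -sin (1/κ)/κ at 1/2, and this produces the term linear in h. -/
theorem le_secondDiff_cosKernel_antipode (hκ : 0 < κ) (h1 : 1 < κ * Real.pi)
    (y : UnitAddTorus (Fin (n + 1))) {h : ℝ} (hh : 0 < h) (hh' : h < 1 / 2) :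
    2 * (Real.sin (1 / κ) / κ) * h - 2 * (2 / κ ^ 2) * h ^ 2 ≤
      cosKernel κ (torusDist (y + Pi.single 0 ((1 / 2 : ℝ) : UnitAddCircle)
          + Pi.single 0 (h : UnitAddCircle)) y)
        + cosKernel κ (torusDist (y + Pi.single 0 ((1 / 2 : ℝ) : UnitAddCircle)
          + Pi.single 0 ((-h : ℝ) : UnitAddCircle)) y)
        - 2 * cosKernel κ (torusDist (y + Pi.single 0 ((1 / 2 : ℝ) : UnitAddCircle)) y) := by
  set x := y + Pi.single 0 ((1 / 2 : ℝ) : UnitAddCircle) with hx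
  have htxy : ((1 / 2 : ℝ) : UnitAddCircle) = x 0 - y 0 := by simp [hx]
  have hs : tailDist x y = 0 := by simp [tailDist, hx]
  obtain ⟨p, hp, hlip, -, -, hp0⟩ := exists_deriv_cosKernel_radial hκ 0
  have ha : |(1 / 2 : ℝ)| = 1 / 2 := by norm_num
  rw [torusDist_add_single htxy, torusDist_add_single htxy, torusDist_eq_sqrt htxy ha.le, hs]
  have e1 : ‖((1 / 2 + h : ℝ) : UnitAddCircle)‖ ^ 2 = (1 / 2 + -h) ^ 2 := by
    have : ((1 / 2 + h : ℝ) : UnitAddCircle) = ((-(1 / 2 + -h) : ℝ) : UnitAddCircle) := by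
      rw [show (1 / 2 + h : ℝ) = -(1 / 2 + -h) + 1 by ring, AddCircle.coe_add, AddCircle.coe_period,
        add_zero]
    rw [this, norm_unitAddCircle_sq (abs_le.mpr ⟨by linarith, by linarith⟩), neg_sq]
  have e2 : ‖((1 / 2 + -h : ℝ) : UnitAddCircle)‖ ^ 2 = (1 / 2 + -h) ^ 2 :=
    norm_unitAddCircle_sq (abs_le.mpr ⟨by linarith, by linarith⟩)
  rw [e1, e2]
  have h2 := abs_le.mp (abs_sub_sub_mul_le_of_deriv_lipschitz hp hlip (1 / 2) (-h))
  rw [hp0 rfl (1 / 2) (by rw [ha]; linarith)] at h2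
  have e3 : 2 * (1 / 2 / κ) = 1 / κ := by ring
  rw [e3] at h2
  have e4 : -Real.sin (1 / κ) / κ = -(Real.sin (1 / κ) / κ) := neg_div _ _
  rw [e4] at h2
  nlinarith

/-- At the antipode of y the second differences integrate to 0, while y contributes at least 2 A h
ν{y} and everything else costs at most a multiple of M h². Divide by h and let h tend to 0. -/
theorem potential_const_atomless_of_one_lt (hκ : 0 < κ) (h1 : 1 < κ * Real.pi)
    {ν : Measure (UnitAddTorus (Fin (n + 1)))} [IsFiniteMeasure ν] {c : ℝ}
    (hc : ∀ x, potential κ ν x = c) (y : UnitAddTorus (Fin (n + 1))) : ν {y} = 0 := by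
  set x := y + Pi.single 0 ((1 / 2 : ℝ) : UnitAddCircle) with hx
  set A := Real.sin (1 / κ) / κ with hA
  have hApos : 0 < A := by
    refine div_pos (Real.sin_pos_of_pos_of_lt_pi (by positivity) ?_) hκ
    rw [div_lt_iff₀ hκ]; linarith
  set M := ν.real Set.univ with hM
  have hM0 : 0 ≤ M := measureReal_nonneg
  have key : ∀ h : ℝ, 0 < h → h < 1 / 2 → A * ν.real {y} ≤ (2 / κ ^ 2 * M) * h := by
    intro h hh hh'
    have hi : ∀ z, Integrable (fun y => cosKernel κ (torusDist z y)) ν :=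
      integrable_cosKernel_torusDist
    have hi2 : Integrable (fun z => cosKernel κ (torusDist (x + Pi.single 0 (h : UnitAddCircle)) z)
        + cosKernel κ (torusDist (x + Pi.single 0 ((-h : ℝ) : UnitAddCircle)) z)) ν :=
      (hi _).add (hi _)
    have hzero : ∫ z, (cosKernel κ (torusDist (x + Pi.single 0 (h : UnitAddCircle)) z)
        + cosKernel κ (torusDist (x + Pi.single 0 ((-h : ℝ) : UnitAddCircle)) z)
        - 2 * cosKernel κ (torusDist x z)) ∂ν = 0 := by
      rw [integral_sub hi2 ((hi _).const_mul 2), integral_add (hi _) (hi _), integral_const_mul]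
      change potential κ ν _ + potential κ ν _ - 2 * potential κ ν _ = 0
      rw [hc, hc, hc]; ring
    have hle : ∫ z, (-(2 * (2 / κ ^ 2) * h ^ 2) + Set.indicator {y} (fun _ => 2 * A * h) z) ∂ν
        ≤ 0 := by
      rw [← hzero]
      refine integral_mono ((integrable_const _).add
        ((integrable_const _).indicator (MeasurableSet.singleton y)))
        (hi2.sub ((hi _).const_mul 2)) fun z => ?_
      by_cases hz : z = y
      · subst hz
        simp only [Set.indicator_of_mem (Set.mem_singleton z)]
        have := le_secondDiff_cosKernel_antipode hκ h1 z hh hh'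
        linarith
      · simp only [Set.indicator_of_notMem (Set.notMem_singleton_iff.mpr hz), add_zero]
        exact neg_le_secondDiff_cosKernel hκ x z h
    rw [integral_add (integrable_const _)
        ((integrable_const _).indicator (MeasurableSet.singleton y)), integral_const,
      integral_indicator_const _ (MeasurableSet.singleton y), smul_eq_mul, smul_eq_mul, ← hM] at hle
    have : h * (A * ν.real {y}) ≤ h * ((2 / κ ^ 2 * M) * h) := by nlinarith
    exact le_of_mul_le_mul_left this hh
  have hlim : Tendsto (fun h : ℝ => (2 / κ ^ 2 * M) * h) (𝓝[>] 0) (𝓝 0) := by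
    have : Tendsto (fun h : ℝ => (2 / κ ^ 2 * M) * h) (𝓝 0) (𝓝 ((2 / κ ^ 2 * M) * 0)) :=
      (continuous_const.mul continuous_id).tendsto 0
    rw [mul_zero] at this
    exact this.mono_left nhdsWithin_le_nhds
  have hle : A * ν.real {y} ≤ 0 := by
    refine ge_of_tendsto hlim ?_
    filter_upwards [Ioo_mem_nhdsGT (show (0 : ℝ) < 1 / 2 by norm_num)] with h hh
    exact key h hh.1 hh.2
  have h0 : ν.real {y} = 0 :=
    le_antisymm (nonpos_of_mul_nonpos_right hle hApos) measureReal_nonneg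
  exact (measureReal_eq_zero_iff (measure_ne_top _ _)).mp h0

/-! ### Jump balance for measures of constant potential when κπ ≤ 1 -/

section
variable {x y : UnitAddTorus (Fin (n + 1))}

theorem thirdDiff_torus {t : ℝ} (ht : (t : UnitAddCircle) = x 0 - y 0) (h : ℝ) :
    thirdDiff (fun u : ℝ => cosKernel κ (torusDist (x + Pi.single 0 (u : UnitAddCircle)) y)) 0 h
      = thirdDiff (fun u : ℝ => cosKernel κ √(‖(u : UnitAddCircle)‖ ^ 2 + tailDist x y ^ 2)) t h := by
  simp only [thirdDiff, torusDist_add_single ht]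
  simp only [zero_add, zero_sub, ← sub_eq_add_neg]

theorem abs_thirdDiff_torus_le (hκ : 0 < κ) (h1 : κ * Real.pi ≤ 1)
    (x y : UnitAddTorus (Fin (n + 1))) {h : ℝ} (hh : 0 < h) (hh' : h ≤ 1 / 6) :
    |thirdDiff (fun u : ℝ => cosKernel κ (torusDist (x + Pi.single 0 (u : UnitAddCircle)) y)) 0 h|
      ≤ 3 * (24 * (2 / κ ^ 2) * h ^ 2) := by
  obtain ⟨t, ht, htxy⟩ := exists_coe_eq_abs_le (x 0 - y 0)
  rw [thirdDiff_torus htxy]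
  exact abs_thirdDiff_unitAddCircle_le hκ h1 _ ht hh hh'

theorem tendsto_thirdDiff_torus_of_ne (hκ : 0 < κ) (h1 : κ * Real.pi ≤ 1)
    (h : torusDist x y ≠ κ * Real.pi / 2) :
    Tendsto (fun h => thirdDiff
      (fun u : ℝ => cosKernel κ (torusDist (x + Pi.single 0 (u : UnitAddCircle)) y)) 0 h / h ^ 2)
      (𝓝[>] 0) (𝓝 0) := by
  obtain ⟨t, ht, htxy⟩ := exists_coe_eq_abs_le (x 0 - y 0)
  rw [torusDist_eq_sqrt htxy ht] at h
  simp_rw [thirdDiff_torus htxy]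
  exact tendsto_thirdDiff_unitAddCircle hκ h1 ht (Or.inr h) (tendsto_thirdDiff_radial_of_ne hκ h)

theorem tendsto_thirdDiff_torus_of_pos (hκ : 0 < κ) (h1 : κ * Real.pi ≤ 1)
    (h : torusDist x y = κ * Real.pi / 2) {t : ℝ} (ht0 : 0 < t) (ht : t < 1 / 2)
    (htxy : (t : UnitAddCircle) = x 0 - y 0) :
    Tendsto (fun h => thirdDiff
      (fun u : ℝ => cosKernel κ (torusDist (x + Pi.single 0 (u : UnitAddCircle)) y)) 0 h / h ^ 2)
      (𝓝[>] 0) (𝓝 (-(6 * t ^ 2 / (κ ^ 2 * (κ * Real.pi / 2) ^ 2)))) := by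
  have ha : |t| < 1 / 2 := by rwa [abs_of_pos ht0]
  rw [torusDist_eq_sqrt htxy ha.le] at h
  simp_rw [thirdDiff_torus htxy]
  exact tendsto_thirdDiff_unitAddCircle hκ h1 ha.le (Or.inl ha)
    (tendsto_thirdDiff_radial_of_pos hκ ht0 h)

theorem tendsto_thirdDiff_torus_of_neg (hκ : 0 < κ) (h1 : κ * Real.pi ≤ 1)
    (h : torusDist x y = κ * Real.pi / 2) {t : ℝ} (ht0 : 0 < t) (ht : t < 1 / 2)
    (htxy : ((-t : ℝ) : UnitAddCircle) = x 0 - y 0) :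
    Tendsto (fun h => thirdDiff
      (fun u : ℝ => cosKernel κ (torusDist (x + Pi.single 0 (u : UnitAddCircle)) y)) 0 h / h ^ 2)
      (𝓝[>] 0) (𝓝 (6 * t ^ 2 / (κ ^ 2 * (κ * Real.pi / 2) ^ 2))) := by
  have ha : |-t| < 1 / 2 := by rwa [abs_neg, abs_of_pos ht0]
  rw [torusDist_eq_sqrt htxy ha.le, neg_sq] at h
  simp_rw [thirdDiff_torus htxy]
  refine tendsto_thirdDiff_unitAddCircle hκ h1 ha.le (Or.inl ha) ?_
  have := (tendsto_thirdDiff_radial_of_pos hκ ht0 h).neg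
  rw [neg_neg] at this
  refine this.congr fun h => ?_
  rw [thirdDiff_neg_of_even (by simp), neg_div]

end

theorem integral_eq_zero_of_tendsto_thirdDiff (hκ : 0 < κ) (h1 : κ * Real.pi ≤ 1)
    {ν : Measure (UnitAddTorus (Fin (n + 1)))} [IsFiniteMeasure ν] {c : ℝ}
    (hc : ∀ x, potential κ ν x = c) (x : UnitAddTorus (Fin (n + 1)))
    {j : UnitAddTorus (Fin (n + 1)) → ℝ}
    (hj : ∀ᵐ y ∂ν, Tendsto (fun h => thirdDiff
      (fun u : ℝ => cosKernel κ (torusDist (x + Pi.single 0 (u : UnitAddCircle)) y)) 0 h / h ^ 2)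
      (𝓝[>] 0) (𝓝 (j y))) : ∫ y, j y ∂ν = 0 := by
  have hi : ∀ z, Integrable (fun y => cosKernel κ (torusDist z y)) ν :=
    integrable_cosKernel_torusDist
  have hint : ∀ h : ℝ, Integrable (fun y => thirdDiff
      (fun u : ℝ => cosKernel κ (torusDist (x + Pi.single 0 (u : UnitAddCircle)) y)) 0 h / h ^ 2)
      ν := fun h =>
    ((((hi _).sub ((hi _).const_mul 3)).add ((hi _).const_mul 3)).sub (hi _)).div_const _
  have hlin : ∀ x₁ x₂ x₃ x₄, ∫ y, (cosKernel κ (torusDist x₁ y) - 3 * cosKernel κ (torusDist x₂ y)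
      + 3 * cosKernel κ (torusDist x₃ y) - cosKernel κ (torusDist x₄ y)) ∂ν = 0 := by
    intro x₁ x₂ x₃ x₄
    have i₂ : Integrable (fun y => cosKernel κ (torusDist x₁ y)
        - 3 * cosKernel κ (torusDist x₂ y)) ν := (hi x₁).sub ((hi x₂).const_mul 3)
    have i₃ : Integrable (fun y => cosKernel κ (torusDist x₁ y)
        - 3 * cosKernel κ (torusDist x₂ y) + 3 * cosKernel κ (torusDist x₃ y)) ν :=
      i₂.add ((hi x₃).const_mul 3)
    rw [integral_sub i₃ (hi x₄), integral_add i₂ ((hi x₃).const_mul 3),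
      integral_sub (hi x₁) ((hi x₂).const_mul 3), integral_const_mul, integral_const_mul]
    change potential κ ν _ - 3 * potential κ ν _ + 3 * potential κ ν _ - potential κ ν _ = 0
    simp only [hc]; ring
  have hzero : ∀ h : ℝ, ∫ y, thirdDiff
      (fun u : ℝ => cosKernel κ (torusDist (x + Pi.single 0 (u : UnitAddCircle)) y)) 0 h / h ^ 2 ∂ν
      = 0 := by
    intro h
    rw [integral_div]
    simp only [thirdDiff]
    rw [hlin, zero_div]
  have hmem : Set.Ioo (0 : ℝ) (1 / 6) ∈ 𝓝[>] (0 : ℝ) := Ioo_mem_nhdsGT (by norm_num)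
  have := tendsto_integral_filter_of_dominated_convergence (μ := ν) (l := 𝓝[>] (0 : ℝ))
    (fun _ => 3 * (24 * (2 / κ ^ 2)))
    (Eventually.of_forall fun h => (hint h).aestronglyMeasurable)
    (by
      filter_upwards [hmem] with h hh
      refine Eventually.of_forall fun y => ?_
      have h2 : 0 < h ^ 2 := pow_pos hh.1 2
      rw [Real.norm_eq_abs, abs_div, abs_of_pos h2, div_le_iff₀ h2]
      linarith [abs_thirdDiff_torus_le hκ h1 x y hh.1 hh.2.le])
    (integrable_const _) hj
  simp only [hzero] at this
  exact tendsto_nhds_unique this tendsto_const_nhds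

end

/-! ### Dimension at least two: isolating a single jump -/

section
variable {κ : ℝ}

theorem finite_setOf_quadratic_eq_zero {a : ℝ} (ha : a ≠ 0) (b c : ℝ) :
    {t : ℝ | a * t ^ 2 + b * t + c = 0}.Finite := by
  open Polynomial in
  have hp : (C a * X ^ 2 + C b * X + C c : ℝ[X]) ≠ 0 := fun h => by
    have := leadingCoeff_quadratic (b := b) (c := c) ha
    rw [h, leadingCoeff_zero] at this
    exact ha this.symm
  refine (Polynomial.finite_setOfPred_isRoot hp).subset fun t ht => ?_
  simpa [Polynomial.IsRoot] using ht

/-- Apart from the centre, a point of the torus has distance `R` from only countably many points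
of a quarter of a planar circle of radius `R`. -/
theorem countable_setOf_torusDist_eq {n : ℕ} {R : ℝ} {y₀ y : UnitAddTorus (Fin (n + 2))}
    (hy : y ≠ y₀) :
    {t : ℝ | t ∈ Set.Ioo 0 R ∧ torusDist (y₀ + Pi.single 0 ((√(R ^ 2 - t ^ 2) : ℝ) : UnitAddCircle)
      + Pi.single 1 (t : UnitAddCircle)) y = R}.Countable := by
  choose w _ hwy using fun i => exists_coe_eq_abs_le (y i - y₀ i)
  -- Let v be the planar vector of length R and u a real lift of y - y₀. Subtracting |v|² = R² from
  -- |v - u|² = R² leaves 2⟨v, u⟩ = |u|². The union runs over the integer translates of the lift,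
  -- and y ≠ y₀ makes |u|² positive.
  have hsub : {t : ℝ | t ∈ Set.Ioo 0 R ∧
      torusDist (y₀ + Pi.single 0 ((√(R ^ 2 - t ^ 2) : ℝ) : UnitAddCircle)
      + Pi.single 1 (t : UnitAddCircle)) y = R} ⊆ ⋃ k : Fin (n + 2) → ℤ,
      {t : ℝ | (0 < ∑ i, (w i + k i) ^ 2) ∧ t ∈ Set.Ioo 0 R ∧
        2 * √(R ^ 2 - t ^ 2) * (w 0 + k 0) + 2 * t * (w 1 + k 1) = ∑ i, (w i + k i) ^ 2} := by
    rintro t ⟨ht, hdist⟩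
    set a := √(R ^ 2 - t ^ 2) with ha
    have hat : a ^ 2 + t ^ 2 = R ^ 2 := by
      rw [ha, Real.sq_sqrt (by nlinarith [ht.1, ht.2])]; ring
    set v : Fin (n + 2) → ℝ := Pi.single 0 a + Pi.single 1 t with hv
    set x : UnitAddTorus (Fin (n + 2)) := y₀ + Pi.single 0 (a : UnitAddCircle)
      + Pi.single 1 (t : UnitAddCircle) with hx
    have hcoord : ∀ i, dist (x i) (y i) ^ 2
        = (v i - (w i + round (v i - w i))) ^ 2 := by
      intro i
      have : x i - y i = ((v i - w i : ℝ) : UnitAddCircle) := by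
        rw [AddCircle.coe_sub, hwy i]
        have : ((v i : ℝ) : UnitAddCircle) = (Pi.single 0 (a : UnitAddCircle)
            + Pi.single 1 (t : UnitAddCircle) : UnitAddTorus (Fin (n + 2))) i := by
          rw [hv]
          refine Fin.cases ?_ (fun i => Fin.cases ?_ (fun i => ?_) i) i
          · simp
          · simp
          · have h1 : (i.succ.succ : Fin (n + 2)) ≠ 1 := by
              rw [← Fin.succ_zero_eq_one]
              exact fun h => Fin.succ_ne_zero i (Fin.succ_injective _ h)
            simp [Pi.single_eq_of_ne h1]
        rw [this, hx, add_assoc, Pi.add_apply]; abel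
      rw [dist_eq_norm, this, UnitAddCircle.norm_eq, sq_abs]
      ring
    have hv0 : v 0 = a := by simp [hv]
    have hv1 : v 1 = t := by simp [hv]
    have hvs : ∀ i : Fin n, v i.succ.succ = 0 := fun i => by
      have h1 : (i.succ.succ : Fin (n + 2)) ≠ 1 := by
        rw [← Fin.succ_zero_eq_one]
        exact fun h => Fin.succ_ne_zero i (Fin.succ_injective _ h)
      simp [hv, Pi.single_eq_of_ne h1]
    have hR : 0 < R := ht.1.trans ht.2
    rw [torusDist, Real.sqrt_eq_iff_eq_sq (Finset.sum_nonneg fun _ _ => sq_nonneg _) hR.le] at hdist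
    simp only [hcoord] at hdist
    refine Set.mem_iUnion.mpr ⟨fun i => round (v i - w i), ?_, ht, ?_⟩
    · refine lt_of_le_of_ne (Finset.sum_nonneg fun _ _ => sq_nonneg _) fun h => hy ?_
      funext i
      have h0 := (Finset.sum_eq_zero_iff_of_nonneg fun i _ =>
        sq_nonneg (w i + (round (v i - w i) : ℝ))).mp h.symm i (Finset.mem_univ i)
      have h1 : w i = ((-round (v i - w i) : ℤ) : ℝ) := by
        push_cast; linarith [pow_eq_zero_iff two_ne_zero |>.mp h0]
      have h2 : ((w i : ℝ) : UnitAddCircle) = 0 := by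
        rw [h1]
        exact (AddCircle.coe_eq_zero_iff 1).mpr ⟨-round (v i - w i), by simp⟩
      rw [hwy i] at h2
      exact sub_eq_zero.mp h2
    · rw [Fin.sum_univ_succ, Fin.sum_univ_succ] at hdist ⊢
      simp only [Fin.succ_zero_eq_one, hv0, hv1, hvs, zero_sub, neg_sq] at hdist ⊢
      linarith
  refine Set.Countable.mono hsub (Set.countable_iUnion fun k => ?_)
  set u := fun i => w i + k i with hu
  set Q := ∑ i, u i ^ 2 with hQ
  by_cases h0 : u 0 = 0 ∧ u 1 = 0
  · refine Set.Countable.mono ?_ Set.countable_empty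
    rintro t ⟨hpos, -, h⟩
    change 2 * √(R ^ 2 - t ^ 2) * u 0 + 2 * t * u 1 = Q at h
    change 0 < Q at hpos
    rw [h0.1, h0.2] at h
    simp only [mul_zero, add_zero] at h
    exact hpos.ne h
  -- Isolating the square root and squaring gives a quadratic equation in t with this leading
  -- coefficient.
  · have hne : 4 * (u 0 ^ 2 + u 1 ^ 2) ≠ 0 := by
      intro h
      exact h0 ⟨by nlinarith [sq_nonneg (u 0), sq_nonneg (u 1)],
        by nlinarith [sq_nonneg (u 0), sq_nonneg (u 1)]⟩
    refine ((finite_setOf_quadratic_eq_zero hne (-(4 * Q * u 1))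
      (Q ^ 2 - 4 * u 0 ^ 2 * R ^ 2)).subset ?_).countable
    rintro t ⟨-, ht, h⟩
    change 2 * √(R ^ 2 - t ^ 2) * u 0 + 2 * t * u 1 = Q at h
    have hs : √(R ^ 2 - t ^ 2) ^ 2 = R ^ 2 - t ^ 2 :=
      Real.sq_sqrt (by nlinarith [ht.1, ht.2])
    have h' : 2 * √(R ^ 2 - t ^ 2) * u 0 = Q - 2 * t * u 1 := by linarith
    have h2 : 4 * (R ^ 2 - t ^ 2) * u 0 ^ 2 = (Q - 2 * t * u 1) ^ 2 := by
      rw [← h', mul_pow, mul_pow, hs]; ring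
    change 4 * (u 0 ^ 2 + u 1 ^ 2) * t ^ 2 + -(4 * Q * u 1) * t + (Q ^ 2 - 4 * u 0 ^ 2 * R ^ 2) = 0
    linarith

theorem not_discrete_of_potential_const {n : ℕ} (hκ : 0 < κ) (h1 : κ * Real.pi ≤ 1)
    {ν : Measure (UnitAddTorus (Fin (n + 2)))} [IsFiniteMeasure ν] {c : ℝ}
    (hc : ∀ x, potential κ ν x = c) (h0 : ν ≠ 0) : ¬ IsDiscreteMeasure ν := by
  intro hd
  obtain ⟨y₀, hy₀⟩ := exists_atom_of_isDiscreteMeasure hd h0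
  obtain ⟨S, hS, hS0⟩ := hd
  set R := κ * Real.pi / 2 with hR
  have hRpos : 0 < R := by have := Real.pi_pos; positivity
  set X : ℝ → UnitAddTorus (Fin (n + 2)) := fun t =>
    y₀ + Pi.single 0 ((√(R ^ 2 - t ^ 2) : ℝ) : UnitAddCircle)
      + Pi.single 1 (t : UnitAddCircle) with hX
  have hbad : (⋃ y ∈ S \ {y₀}, {t : ℝ | t ∈ Set.Ioo 0 R ∧ torusDist (X t) y = R}).Countable :=
    (hS.mono Set.sdiff_subset).biUnion fun y hy => countable_setOf_torusDist_eq hy.2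
  have hnc : ¬ (Set.Ioo 0 R).Countable := fun h => by
    have := h.measure_zero volume
    rw [Real.volume_Ioo, sub_zero, ENNReal.ofReal_eq_zero] at this
    linarith
  -- The bad parameters are countable and the interval is not, so some point on the quarter circle
  -- sees only y₀ at distance R.
  obtain ⟨t, ht, htbad⟩ := Set.not_subset.mp fun h => hnc (hbad.mono h)
  have hgood : ∀ y ∈ S, y ≠ y₀ → torusDist (X t) y ≠ R := fun y hy hne he =>
    htbad (Set.mem_biUnion (show y ∈ S \ {y₀} from ⟨hy, hne⟩) ⟨ht, he⟩)
  set a := √(R ^ 2 - t ^ 2) with ha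
  have hat : a ^ 2 + t ^ 2 = R ^ 2 := by
    rw [ha, Real.sq_sqrt (by nlinarith [ht.1, ht.2])]; ring
  have ha0 : 0 < a := Real.sqrt_pos.mpr (by nlinarith [ht.1, ht.2])
  have haR : a < R := by nlinarith [ht.1]
  have hX0 : (a : UnitAddCircle) = X t 0 - y₀ 0 := by simp [hX, ← ha]
  have hdist : torusDist (X t) y₀ = R := by
    rw [torusDist_eq_sqrt hX0 (abs_le.mpr ⟨by linarith, by linarith⟩)]
    have : tailDist (X t) y₀ ^ 2 = t ^ 2 := by
      rw [tailDist, Real.sq_sqrt (Finset.sum_nonneg fun _ _ => sq_nonneg _), Fin.sum_univ_succ,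
        Finset.sum_eq_zero, add_zero]
      · rw [dist_eq_norm, ← norm_unitAddCircle_sq (t := t)
          (abs_le.mpr ⟨by linarith [ht.1], by linarith [ht.2]⟩)]
        congr 2
        simp [hX]
      · intro i _
        have h1 : (i.succ.succ : Fin (n + 2)) ≠ 1 := by
          rw [← Fin.succ_zero_eq_one]
          exact fun h => Fin.succ_ne_zero i (Fin.succ_injective _ h)
        simp [hX, Pi.single_eq_of_ne h1]
    rw [this, hat, Real.sqrt_sq hRpos.le]
  set J := -(6 * a ^ 2 / (κ ^ 2 * (κ * Real.pi / 2) ^ 2)) with hJ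
  have hJ0 : J ≠ 0 := neg_ne_zero.mpr (by positivity)
  have hint := integral_eq_zero_of_tendsto_thirdDiff hκ h1 hc (X t)
    (j := Set.indicator {y₀} fun _ => J) (by
      have hSae : ∀ᵐ y ∂ν, y ∈ S := hS0
      filter_upwards [hSae] with y hy
      by_cases hyy : y = y₀
      · subst hyy
        rw [Set.indicator_of_mem (Set.mem_singleton y)]
        exact tendsto_thirdDiff_torus_of_pos hκ h1 hdist ha0 (by linarith) hX0
      · rw [Set.indicator_of_notMem (Set.notMem_singleton_iff.mpr hyy)]
        exact tendsto_thirdDiff_torus_of_ne hκ h1 (hgood y hy hyy))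
  rw [integral_indicator_const _ (MeasurableSet.singleton y₀), smul_eq_mul, mul_eq_zero,
    measureReal_eq_zero_iff (measure_ne_top _ _)] at hint
  exact hint.elim hy₀ hJ0

/-! ### Dimension one: invariance of atoms under the shift by κπ -/

theorem torusDist_fin_one (x y : UnitAddTorus (Fin 1)) : torusDist x y = ‖x 0 - y 0‖ := by
  rw [torusDist, Fin.sum_univ_one, dist_eq_norm, Real.sqrt_sq (norm_nonneg _)]

/-- The midpoint x = y + R has exactly y and y + κπ at distance R, on opposite sides, so their jumps
have opposite signs and must balance. Strictness of κπ < 1 keeps the two points distinct. -/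
theorem measure_singleton_add_of_potential_const (hκ : 0 < κ) (h1 : κ * Real.pi < 1)
    {ν : Measure (UnitAddTorus (Fin 1))} [IsFiniteMeasure ν] {c : ℝ}
    (hc : ∀ x, potential κ ν x = c) (y : UnitAddTorus (Fin 1)) :
    ν {y + fun _ => ((κ * Real.pi : ℝ) : UnitAddCircle)} = ν {y} := by
  set R := κ * Real.pi / 2 with hR
  have hRpos : 0 < R := by have := Real.pi_pos; positivity
  set x : UnitAddTorus (Fin 1) := y + fun _ => (R : UnitAddCircle) with hx
  set y' : UnitAddTorus (Fin 1) := y + fun _ => ((κ * Real.pi : ℝ) : UnitAddCircle) with hy'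
  have hxy : (R : UnitAddCircle) = x 0 - y 0 := by simp [hx]
  have hκR : ((κ * Real.pi : ℝ) : UnitAddCircle) = (R : UnitAddCircle) + (R : UnitAddCircle) := by
    rw [← AddCircle.coe_add, hR, add_halves]
  have hxy' : ((-R : ℝ) : UnitAddCircle) = x 0 - y' 0 := by
    simp only [hx, hy', Pi.add_apply, AddCircle.coe_neg, hκR]; abel
  have hRabs : |R| ≤ 1 / 2 := by rw [abs_of_pos hRpos]; linarith
  have hnR : ‖(R : UnitAddCircle)‖ = R := by
    rw [(AddCircle.norm_coe_eq_abs_iff 1 one_ne_zero).mpr (by simpa using hRabs),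
      abs_of_pos hRpos]
  have hd : torusDist x y = R := by rw [torusDist_fin_one, ← hxy, hnR]
  have hd' : torusDist x y' = R := by
    rw [torusDist_fin_one, ← hxy', AddCircle.coe_neg, norm_neg, hnR]
  have hne : y' ≠ y := by
    intro h
    have h2 : ((κ * Real.pi : ℝ) : UnitAddCircle) = 0 := by
      have := congrFun h 0
      simpa [hy'] using this
    obtain ⟨m, hm⟩ := (AddCircle.coe_eq_zero_iff 1).mp h2
    rw [zsmul_eq_mul, mul_one] at hm
    have h3 : (0 : ℝ) < m := by rw [hm]; linarith
    have h4 : (m : ℝ) < 1 := by rw [hm]; exact h1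
    have h3' : 0 < m := by exact_mod_cast h3
    have h4' : m < 1 := by exact_mod_cast h4
    omega
  have honly : ∀ z, torusDist x z = R → z = y ∨ z = y' := by
    intro z hz
    obtain ⟨t, ht, htz⟩ := exists_coe_eq_abs_le (x 0 - z 0)
    rw [torusDist_fin_one, ← htz,
      (AddCircle.norm_coe_eq_abs_iff 1 one_ne_zero).mpr (by simpa using ht)] at hz
    rcases eq_or_eq_neg_of_abs_eq hz with h | h
    · left
      funext i
      rw [Subsingleton.elim i 0]
      rw [h, hxy] at htz
      exact (sub_right_injective htz).symm
    · right
      funext i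
      rw [Subsingleton.elim i 0]
      rw [h, hxy'] at htz
      exact (sub_right_injective htz).symm
  set J := 6 * R ^ 2 / (κ ^ 2 * R ^ 2) with hJ
  have hJ0 : J ≠ 0 := by positivity
  have hint := integral_eq_zero_of_tendsto_thirdDiff hκ h1.le hc x
    (j := fun z => Set.indicator {y'} (fun _ => J) z - Set.indicator {y} (fun _ => J) z) (by
      refine Eventually.of_forall fun z => ?_
      by_cases hz : torusDist x z = R
      · rcases honly z hz with rfl | rfl
        · rw [Set.indicator_of_notMem (Set.notMem_singleton_iff.mpr hne.symm),
            Set.indicator_of_mem (Set.mem_singleton _), zero_sub]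
          exact tendsto_thirdDiff_torus_of_pos hκ h1.le hz hRpos (by linarith) hxy
        · rw [Set.indicator_of_notMem (Set.notMem_singleton_iff.mpr hne),
            Set.indicator_of_mem (Set.mem_singleton _), sub_zero]
          exact tendsto_thirdDiff_torus_of_neg hκ h1.le hz hRpos (by linarith) hxy'
      · rw [Set.indicator_of_notMem (Set.notMem_singleton_iff.mpr fun h => hz (by rw [h, hd'])),
          Set.indicator_of_notMem (Set.notMem_singleton_iff.mpr fun h => hz (by rw [h, hd])), sub_zero]
        exact tendsto_thirdDiff_torus_of_ne hκ h1.le hz)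
  rw [integral_sub ((integrable_const _).indicator (MeasurableSet.singleton _))
      ((integrable_const _).indicator (MeasurableSet.singleton _)),
    integral_indicator_const _ (MeasurableSet.singleton _),
    integral_indicator_const _ (MeasurableSet.singleton _), smul_eq_mul, smul_eq_mul,
    ← sub_mul, mul_eq_zero, or_iff_left hJ0, sub_eq_zero] at hint
  exact (measureReal_eq_measureReal_iff).mp hint

theorem potential_const_atomless_of_irrational (hκ : 0 < κ) (hirr : Irrational (κ * Real.pi))
    (h1 : κ * Real.pi < 1) {ν : Measure (UnitAddTorus (Fin 1))} [IsFiniteMeasure ν] {c : ℝ}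
    (hc : ∀ x, potential κ ν x = c) (y : UnitAddTorus (Fin 1)) : ν {y} = 0 := by
  set L := κ * Real.pi with hL
  set v : ℕ → UnitAddTorus (Fin 1) := fun k => y + k • fun _ => (L : UnitAddCircle) with hv
  have hmass : ∀ k, ν {v k} = ν {y} := by
    intro k
    induction k with
    | zero => simp [hv]
    | succ k ih =>
      rw [← ih, ← measure_singleton_add_of_potential_const hκ h1 hc (v k)]
      simp only [hv, succ_nsmul, add_assoc]; rfl
  have hinj : Function.Injective v := by
    intro k l hkl
    have h0 := congrFun hkl 0
    simp only [hv, Pi.add_apply, Pi.smul_apply, add_right_inj] at h0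
    rw [← sub_eq_zero, ← AddCircle.coe_nsmul, ← AddCircle.coe_nsmul, ← AddCircle.coe_sub] at h0
    obtain ⟨m, hm⟩ := (AddCircle.coe_eq_zero_iff 1).mp h0
    simp only [zsmul_eq_mul, nsmul_eq_mul, mul_one] at hm
    by_contra hne
    have hkl' : ((k : ℤ) - l : ℤ) ≠ 0 := by omega
    have hirr' := hirr.intCast_mul hkl'
    refine hirr'.ne_int m ?_
    rw [hm]; push_cast; ring
  by_contra hy
  have := (Set.infinite_range_of_injective hinj).meas_eq_top (μ := ν) ⟨ν {y}, hy, by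
    rintro _ ⟨k, rfl⟩
    exact (hmass k).ge⟩
  exact measure_ne_top ν _ this

/-! ### Dimension one: finitely atomic barycenters for rational κπ -/

theorem sum_cos_add_two_pi_mul_div {m : ℕ} (hm : 2 ≤ m) (α : ℝ) :
    ∑ k ∈ Finset.range m, Real.cos (α + 2 * Real.pi * k / m) = 0 := by
  have hζ := Complex.isPrimitiveRoot_exp m (by omega)
  have h0 := hζ.geom_sum_eq_zero (by omega)
  have h1 : ∀ k : ℕ, Real.cos (α + 2 * Real.pi * k / m)
      = (Complex.exp (α * Complex.I) * Complex.exp (2 * Real.pi * Complex.I / m) ^ k).re := by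
    intro k
    rw [← Complex.exp_nat_mul, ← Complex.exp_add,
      show (α * Complex.I + k * (2 * Real.pi * Complex.I / m) : ℂ)
        = ((α + 2 * Real.pi * k / m : ℝ) : ℂ) * Complex.I by push_cast; ring,
      Complex.exp_ofReal_mul_I_re]
  simp_rw [h1]
  rw [← Complex.re_sum, ← Finset.mul_sum, h0, mul_zero, Complex.zero_re]

/-- Translates of the kernel along a full cycle add up to a constant if the support of the kernel
is a multiple of the step. -/
theorem sum_cosKernel_eq (hκ : 0 < κ) {m r : ℕ} (hm : 2 ≤ m)
    (hL : κ * Real.pi = m / (m + r : ℕ)) (t : ℝ) :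
    ∑ k ∈ Finset.range (m + r), cosKernel κ ‖((t + k / (m + r : ℕ) : ℝ) : UnitAddCircle)‖
      = m / 2 := by
  set N := m + r with hN
  have hNpos : (0 : ℝ) < N := by
    have : 0 < N := by omega
    exact_mod_cast this
  have hm0 : (0 : ℝ) < m := by
    have : 0 < m := by omega
    exact_mod_cast this
  have hNr : (N : ℝ) = m + r := by rw [hN]; push_cast; ring
  have hNL : N * (κ * Real.pi) = m := by rw [hL]; field_simp
  set S : ℝ → ℝ := fun t =>
    ∑ k ∈ Finset.range N, cosKernel κ ‖((t + k / N : ℝ) : UnitAddCircle)‖ with hS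
  have hper : Function.Periodic S (1 / N) := by
    intro t
    have e : S (t + 1 / N) = ∑ k ∈ Finset.range N,
        cosKernel κ ‖((t + (k + 1 : ℕ) / N : ℝ) : UnitAddCircle)‖ := by
      refine Finset.sum_congr rfl fun k _ => ?_
      rw [show t + 1 / (N : ℝ) + k / N = t + (k + 1 : ℕ) / N by push_cast; ring]
    have h1 := Finset.sum_range_succ
      (fun k : ℕ => cosKernel κ ‖((t + k / N : ℝ) : UnitAddCircle)‖) N
    have h2 := Finset.sum_range_succ'
      (fun k : ℕ => cosKernel κ ‖((t + k / N : ℝ) : UnitAddCircle)‖) N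
    have h3 : ((t + N / N : ℝ) : UnitAddCircle) = ((t + (0 : ℕ) / N : ℝ) : UnitAddCircle) := by
      rw [div_self hNpos.ne', AddCircle.coe_add, AddCircle.coe_period]; simp
    rw [h2] at h1
    rw [h3] at h1
    rw [e]
    linarith
  change S t = m / 2
  -- With u in [-R, -R + 1/N), the first m translates lie in the support [-R, R] and the other r lie
  -- outside it modulo 1.
  obtain ⟨u, hu, htu⟩ := hper.exists_mem_Ico (by positivity) t (-(κ * Real.pi / 2))
  rw [htu]
  have hlo : ∀ k : ℝ, -(κ * Real.pi / 2) + k / N ≤ u + k / N := fun k => by linarith [hu.1]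
  have hhi : ∀ k : ℝ, u + k / N < -(κ * Real.pi / 2) + (k + 1) / N := fun k => by
    have := hu.2
    rw [add_div]; linarith
  have hL1 : κ * Real.pi ≤ 1 := by
    rw [hL, div_le_one hNpos, hNr]; linarith [(Nat.cast_nonneg r : (0 : ℝ) ≤ r)]
  simp only [hS]
  rw [hN, Finset.sum_range_add, ← hN]
  have hsecond : ∑ k ∈ Finset.range r,
      cosKernel κ ‖((u + (m + k : ℕ) / N : ℝ) : UnitAddCircle)‖ = 0 := by
    refine Finset.sum_eq_zero fun k hk => cosKernel_of_le hκ ?_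
    have hk' : (k : ℝ) + 1 ≤ r := by exact_mod_cast Finset.mem_range.mp hk
    set v := u + (m + k : ℕ) / (N : ℝ) with hv
    have h1 : κ * Real.pi / 2 ≤ v := by
      have h2 : κ * Real.pi ≤ (m + k : ℕ) / (N : ℝ) := by
        rw [hL]; gcongr; omega
      linarith [hu.1]
    have h2 : v ≤ 1 - κ * Real.pi / 2 := by
      have h3 : (((m + k : ℕ) : ℝ) + 1) / N ≤ 1 := by
        rw [div_le_one hNpos, hNr]; push_cast; linarith
      linarith [hhi (m + k : ℕ)]
    rcases le_total v (1 / 2) with h | h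
    · have hv0 : 0 ≤ v := le_trans (by have := Real.pi_pos; positivity) h1
      rw [(AddCircle.norm_coe_eq_abs_iff 1 one_ne_zero).mpr
        (by rw [abs_of_nonneg hv0]; simpa using h), abs_of_nonneg hv0]
      exact h1
    · have : ‖(v : UnitAddCircle)‖ = ‖((v - 1 : ℝ) : UnitAddCircle)‖ := by
        simp [AddCircle.coe_period]
      have hv1 : v - 1 ≤ 0 := by
        have : 0 < κ * Real.pi / 2 := by have := Real.pi_pos; positivity
        linarith
      rw [this, (AddCircle.norm_coe_eq_abs_iff 1 one_ne_zero).mpr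
        (by rw [abs_of_nonpos hv1, abs_one]; linarith), abs_of_nonpos hv1]
      linarith
  have hfirst : ∀ k ∈ Finset.range m, cosKernel κ ‖((u + k / N : ℝ) : UnitAddCircle)‖
      = 1 / 2 + Real.cos (2 * u / κ + 2 * Real.pi * k / m) / 2 := by
    intro k hk
    have hk' : (k : ℝ) + 1 ≤ m := by exact_mod_cast Finset.mem_range.mp hk
    have h1 : -(κ * Real.pi / 2) ≤ u + k / N := by
      have : 0 ≤ (k : ℝ) / N := by positivity
      linarith [hlo k]
    have h2 : u + k / N ≤ κ * Real.pi / 2 := by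
      have : ((k : ℝ) + 1) / N ≤ κ * Real.pi := by rw [hL]; gcongr
      linarith [hhi k]
    have habs : |u + k / N| ≤ κ * Real.pi / 2 := abs_le.mpr ⟨h1, h2⟩
    rw [(AddCircle.norm_coe_eq_abs_iff 1 one_ne_zero).mpr (by rw [abs_one]; linarith),
      cosKernel, min_eq_left habs]
    have : |u + k / N| / κ = |(u + k / N) / κ| := by rw [abs_div, abs_of_pos hκ]
    rw [this, Real.cos_abs, Real.cos_sq]
    -- Since N κπ = m, a step 1/N advances the doubled angle by 2π/m, so m steps make one full turn.
    have e : 2 * ((u + k / N) / κ) = 2 * u / κ + 2 * Real.pi * k / m := by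
      rw [← hNL]
      have := Real.pi_ne_zero
      field_simp
    rw [e]
  rw [hsecond, add_zero, Finset.sum_congr rfl hfirst, Finset.sum_add_distrib, ← Finset.sum_div,
    ← Finset.sum_div, sum_cos_add_two_pi_mul_div hm]
  simp

theorem exists_finitelyAtomic_barycenter (hκ : 0 < κ) {m r : ℕ} (hm : 2 ≤ m)
    (hL : κ * Real.pi = m / (m + r : ℕ)) :
    ∃ ν : FiniteMeasure (UnitAddTorus (Fin 1)), IsTorusBarycenter κ ν ∧
      IsFinitelyAtomic (ν : Measure (UnitAddTorus (Fin 1))) := by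
  set N := m + r with hN
  set y : ℕ → UnitAddTorus (Fin 1) := fun k _ => ((-(k / N) : ℝ) : UnitAddCircle) with hy
  -- The weight is fixed by c * (m/2) = G².
  set c : ℝ := 2 * meanKernel κ 1 ^ 2 / m with hc
  have hc0 : 0 ≤ c := by positivity
  have hm0 : (m : ℝ) ≠ 0 := by
    have : m ≠ 0 := by omega
    exact_mod_cast this
  refine ⟨⟨c.toNNReal • ∑ k ∈ Finset.range N, Measure.dirac (y k), inferInstance⟩, ?_, ?_⟩
  · refine (isTorusBarycenter_iff hκ _).mpr fun x => ?_
    change ∫ z, cosKernel κ (torusDist x z)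
      ∂(c.toNNReal • ∑ k ∈ Finset.range N, Measure.dirac (y k)) = _
    obtain ⟨t, ht⟩ := QuotientAddGroup.mk_surjective (x 0)
    rw [integral_smul_nnreal_measure, integral_finsetSum_measure fun k _ =>
      integrable_cosKernel_torusDist x]
    simp only [integral_dirac]
    have : ∀ k : ℕ, cosKernel κ (torusDist x (y k))
        = cosKernel κ ‖((t + k / N : ℝ) : UnitAddCircle)‖ := by
      intro k
      rw [torusDist_fin_one, ← ht]
      congr 2
      simp only [hy, AddCircle.coe_neg, sub_neg_eq_add, AddCircle.coe_add]
    simp only [this]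
    rw [hN, sum_cosKernel_eq hκ hm hL, NNReal.smul_def, Real.coe_toNNReal _ hc0, smul_eq_mul, hc]
    field_simp
  · refine ⟨y '' (Finset.range N : Set ℕ), (Finset.finite_toSet _).image _, ?_⟩
    change (c.toNNReal • ∑ k ∈ Finset.range N, Measure.dirac (y k)) _ = 0
    rw [Measure.smul_apply, Measure.finsetSum_apply, Finset.sum_eq_zero, smul_zero]
    intro k hk
    have hmem : y k ∉ (y '' (Finset.range N : Set ℕ))ᶜ := fun h =>
      h (Set.mem_image_of_mem y (Finset.mem_coe.mpr hk))
    rw [Measure.dirac_apply, Set.indicator_of_notMem hmem]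

end

theorem mainTheorem10 (κ : ℝ) (hκ : 0 < κ) :
    (∀ d : ℕ, 1 < d →
      ¬ ∃ ν : MeasureTheory.FiniteMeasure (UnitAddTorus (Fin d)),
        IsTorusBarycenter κ ν ∧ IsDiscreteMeasure (ν : MeasureTheory.Measure (UnitAddTorus (Fin d)))) ∧
    ((Irrational (κ * Real.pi) ∨ 1 < κ * Real.pi) →
      ¬ ∃ ν : MeasureTheory.FiniteMeasure (UnitAddTorus (Fin 1)),
        IsTorusBarycenter κ ν ∧ IsDiscreteMeasure (ν : MeasureTheory.Measure (UnitAddTorus (Fin 1)))) ∧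
    (¬ (Irrational (κ * Real.pi) ∨ 1 < κ * Real.pi) →
      ∃ ν : MeasureTheory.FiniteMeasure (UnitAddTorus (Fin 1)),
        IsTorusBarycenter κ ν ∧ IsFinitelyAtomic (ν : MeasureTheory.Measure (UnitAddTorus (Fin 1)))) := by
  have hL0 : 0 < κ * Real.pi := mul_pos hκ Real.pi_pos
  refine ⟨?_, ?_, ?_⟩
  · rintro d hd ⟨ν, hb, hdisc⟩
    obtain ⟨n, rfl⟩ : ∃ n, d = n + 2 := ⟨d - 2, by omega⟩
    rw [isTorusBarycenter_iff hκ] at hb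
    have h0 := ne_zero_of_potential_eq hκ hb
    rcases le_or_gt (κ * Real.pi) 1 with h1 | h1
    · exact not_discrete_of_potential_const hκ h1 hb h0 hdisc
    · obtain ⟨y, hy⟩ := exists_atom_of_isDiscreteMeasure hdisc h0
      exact hy (potential_const_atomless_of_one_lt hκ h1 hb y)
  · rintro h ⟨ν, hb, hdisc⟩
    rw [isTorusBarycenter_iff hκ] at hb
    obtain ⟨y, hy⟩ := exists_atom_of_isDiscreteMeasure hdisc (ne_zero_of_potential_eq hκ hb)
    rcases le_or_gt (κ * Real.pi) 1 with h1 | h1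
    · have hirr := h.resolve_right (not_lt.mpr h1)
      exact hy (potential_const_atomless_of_irrational hκ hirr
        (lt_of_le_of_ne h1 hirr.ne_one) hb y)
    · exact hy (potential_const_atomless_of_one_lt hκ h1 hb y)
  · intro h
    push Not at h
    obtain ⟨hrat, h1⟩ := h
    rw [Irrational, not_not] at hrat
    obtain ⟨q, hq⟩ := hrat
    have hq0 : 0 < q := by rw [← hq] at hL0; exact_mod_cast hL0
    have hq1 : q ≤ 1 := by rw [← hq] at h1; exact_mod_cast h1
    obtain ⟨p, hp⟩ := Int.eq_ofNat_of_zero_le (Rat.num_nonneg.mpr hq0.le)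
    have hp0 : 0 < p := by
      have := Rat.num_pos.mpr hq0
      omega
    have hpq : p ≤ q.den := by
      have := Rat.num_le_denom_iff.mpr hq1
      omega
    -- The reduced fraction is doubled because m ≥ 2 is needed for the cosines to cancel, and the
    -- numerator may be 1.
    refine exists_finitelyAtomic_barycenter hκ (m := 2 * p) (r := 2 * (q.den - p)) (by omega) ?_
    rw [← hq, show 2 * p + 2 * (q.den - p) = 2 * q.den by omega, Rat.cast_def, hp]
    push_cast
    rw [mul_div_mul_left _ _ two_ne_zero]
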